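/- Let $k$ be a field, let $A$ and $B$ be nonzero finite-dimensional (associative, unital) $k$-algebras, let $T$ be a finite-dimensional left $A$-module and $L$ a finite-dimensional left $B$-module. Write $\otimes=\otimes_k$ and regard $T\otimes L$ as a left $(A\otimes B)$-module via $(a\otimes b)(t\otimes l)=at\otimes bl$. For a finite-dimensional $k$-algebra $R$, a finite-dimensional left $R$-module $M$ is called cotilting if for some integer $r\ge 0$: 1. the injective dimension of $M$ is at most $r$; 2. $\mathrm{Ext}^s_R(M,M)=0$ for all $s\ge 1$; 3. there is, for some $m\ge 0$, an exact sequence of $R$-modules $0\to M_m\to\cdots\to M_0\to D(R_R)\to 0$ in which every $M_j$ is a direct summand of a finite direct sum of copies of $M$. Here $D(R_R)=\mathrm{Hom}_k(R,k)$ is the left $R$-module with $(af)(x)=f(xa)$. Then $T\otimes L$ is a cotilting $(A\otimes B)$-module if and only if $T$ is a cotilting $A$-module and $L$ is a cotilting $B$-module. In this case $\mathrm{End}_{A\otimes B}(T\otimes L)\cong \mathrm{End}_A(T)\otimes \mathrm{End}_B(L)$ as $k$-algebras. -/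

import Mathlib

open scoped TensorProduct

universe u

section ExternalTensorProduct

/-- The external tensor product over `k` of an `A`-module `T` and a `B`-module `L`. It is a synonym
of `T ⊗[k] L`, which carries the `A ⊗[k] B`-module structure `(a ⊗ b) • (t ⊗ l) = (a • t) ⊗ (b • l)`
constructed below. -/
def ExtTensor (k : Type*) [Field k] (T L : Type*) [AddCommGroup T] [AddCommGroup L]
    [Module k T] [Module k L] : Type _ := T ⊗[k] L

noncomputable instance (k : Type*) [Field k] (T L : Type*) [AddCommGroup T] [AddCommGroup L]
    [Module k T] [Module k L] : AddCommGroup (ExtTensor k T L) :=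
  inferInstanceAs (AddCommGroup (T ⊗[k] L))

noncomputable instance (k : Type*) [Field k] (T L : Type*) [AddCommGroup T] [AddCommGroup L]
    [Module k T] [Module k L] : Module k (ExtTensor k T L) :=
  inferInstanceAs (Module k (T ⊗[k] L))

/-- The action of `A ⊗[k] B` on `T ⊗[k] L` as an algebra homomorphism. -/
noncomputable def extTensorAction (k A B T L : Type*) [Field k] [Ring A] [Ring B]
    [Algebra k A] [Algebra k B] [AddCommGroup T] [AddCommGroup L] [Module k T] [Module k L]
    [Module A T] [Module B L] [IsScalarTower k A T] [IsScalarTower k B L] :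
    A ⊗[k] B →ₐ[k] Module.End k (T ⊗[k] L) :=
  (Module.endTensorEndAlgHom (R := k) (S := k) (A := k) (M := T) (N := L)).comp
    (Algebra.TensorProduct.map (Algebra.lsmul k k T) (Algebra.lsmul k k L))

noncomputable instance (k A B T L : Type*) [Field k] [Ring A] [Ring B]
    [Algebra k A] [Algebra k B] [AddCommGroup T] [AddCommGroup L] [Module k T] [Module k L]
    [Module A T] [Module B L] [IsScalarTower k A T] [IsScalarTower k B L] :
    Module (A ⊗[k] B) (ExtTensor k T L) :=
  Module.compHom (T ⊗[k] L) (extTensorAction k A B T L).toRingHom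

theorem ExtTensor.tmul_smul_tmul (k A B T L : Type*) [Field k] [Ring A] [Ring B]
    [Algebra k A] [Algebra k B] [AddCommGroup T] [AddCommGroup L] [Module k T] [Module k L]
    [Module A T] [Module B L] [IsScalarTower k A T] [IsScalarTower k B L]
    (a : A) (b : B) (t : T) (l : L) :
    (a ⊗ₜ[k] b) • (show ExtTensor k T L from t ⊗ₜ[k] l) =
      (show ExtTensor k T L from (a • t) ⊗ₜ[k] (b • l)) :=
  rfl

instance (k A B T L : Type*) [Field k] [Ring A] [Ring B]
    [Algebra k A] [Algebra k B] [AddCommGroup T] [AddCommGroup L] [Module k T] [Module k L]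
    [Module A T] [Module B L] [IsScalarTower k A T] [IsScalarTower k B L] :
    IsScalarTower k (A ⊗[k] B) (ExtTensor k T L) where
  smul_assoc c x v := by
    change extTensorAction k A B T L (c • x) v = c • extTensorAction k A B T L x v
    rw [map_smul]
    rfl

end ExternalTensorProduct

section Cotilting

/-- The left `A`-module `D(A_A) = Hom_k(A, k)`, the `k`-dual of the right regular module, with
`(a • f) x = f (x * a)`. -/
def DualRegular (k A : Type*) [Field k] [Ring A] [Algebra k A] : Type _ := A →ₗ[k] k

noncomputable instance (k A : Type*) [Field k] [Ring A] [Algebra k A] :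
    AddCommGroup (DualRegular k A) :=
  inferInstanceAs (AddCommGroup (A →ₗ[k] k))

noncomputable instance (k A : Type*) [Field k] [Ring A] [Algebra k A] :
    Module A (DualRegular k A) where
  smul a f := LinearMap.comp (show A →ₗ[k] k from f) (LinearMap.mulRight k a)
  one_smul f := LinearMap.ext fun x => congrArg (show A →ₗ[k] k from f) (mul_one x)
  mul_smul a b f := LinearMap.ext fun x =>
    congrArg (show A →ₗ[k] k from f) (mul_assoc x a b).symm
  smul_zero _ := LinearMap.ext fun _ => rfl
  smul_add _ _ _ := LinearMap.ext fun _ => rfl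
  add_smul a b f := LinearMap.ext fun x =>
    (congrArg (show A →ₗ[k] k from f) (mul_add x a b)).trans
      (map_add (show A →ₗ[k] k from f) (x * a) (x * b))
  zero_smul f := LinearMap.ext fun x =>
    (congrArg (show A →ₗ[k] k from f) (mul_zero x)).trans (map_zero (show A →ₗ[k] k from f))

/-- `X` belongs to `add(T)`: it is a direct summand of a finite direct sum of copies of `T`. -/
def InAdd (A T X : Type*) [Ring A] [AddCommGroup T] [Module A T] [AddCommGroup X] [Module A X] :
    Prop :=
  ∃ (n : ℕ) (i : X →ₗ[A] (Fin n → T)) (p : (Fin n → T) →ₗ[A] X), p ∘ₗ i = LinearMap.id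

/-- There is an exact sequence `0 → X_m → ⋯ → X_0 → Y → 0` with every `X_j` in `add(T)`. The
sequence is extended to the left by zero modules: `X_j = 0` for `j > m`. -/
def HasFiniteAddResolution (A T Y : Type u) [Ring A] [AddCommGroup T] [Module A T]
    [AddCommGroup Y] [Module A Y] : Prop :=
  ∃ (m : ℕ) (X : ℕ → ModuleCat.{u} A) (d : ∀ j, X (j + 1) →ₗ[A] X j) (ε : X 0 →ₗ[A] Y),
    (∀ j, InAdd A T (X j)) ∧ (∀ j, m < j → Subsingleton (X j)) ∧
    Function.Surjective ε ∧ Function.Exact (d 0) ε ∧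
    ∀ j, Function.Exact (d (j + 1)) (d j)

/-- `T` is an `r`-cotilting module over the finite-dimensional `k`-algebra `A`: its injective
dimension is at most `r`, `Ext^s_A(T, T) = 0` for all `s ≥ 1`, and there is an exact sequence
`0 → T_m → ⋯ → T_0 → D(A_A) → 0` with every `T_j` in `add(T)`. -/
structure IsRCotilting (k A T : Type u) [Field k] [Ring A] [Algebra k A] [AddCommGroup T]
    [Module A T] (r : ℕ) : Prop where
  injDim_le : CategoryTheory.HasInjectiveDimensionLE (ModuleCat.of A T) r
  ext_self : ∀ s : ℕ, 1 ≤ s →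
    Subsingleton (CategoryTheory.Abelian.Ext (ModuleCat.of A T) (ModuleCat.of A T) s)
  resolution : HasFiniteAddResolution A T (DualRegular k A)

/-- `T` is a cotilting module: it is `r`-cotilting for some `r`. -/
def IsCotilting (k A T : Type u) [Field k] [Ring A] [Algebra k A] [AddCommGroup T]
    [Module A T] : Prop :=
  ∃ r : ℕ, IsRCotilting k A T r

end Cotilting

/-! Over a field the external tensor product is exact in each variable, and for finite-dimensional
modules every `A ⊗ B`-linear map `X ⊗ M → Y ⊗ N` is a finite sum of maps `u ⊗ w`
(`exists_eq_sum_map`). This already gives the endomorphism algebra.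

If `T` and `L` are cotilting, the three conditions pass to `T ⊗ L` by dimension shifting, without a
Künneth formula. Free covers of each factor reduce the vanishing of `Ext` to the projective module
`A ⊗ B`; degree one is settled by extending each `u` or `w` separately. Embeddings into powers of
`D(A)` and `D(B)` reduce the injective dimension to `D(A) ⊗ D(B) ≅ D(A ⊗ B)`, which is injective.
Resolutions are combined with `AddResolution.cokernel`: when `T` has no self-extensions, the
cokernel of an injection between modules with `add(T)`-resolutions of length at most `m` has one of
length at most `m + 1`.

Conversely, if `T ⊗ L` is cotilting, then `T` and `L` are nonzero because `D(A ⊗ B)` is. Choose `l ∈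
L` and a functional `φ` with `φ l = 1`. The natural map `x ↦ x ⊗ l` is split by contraction with
`φ`, so `Ext_A(X, Y)` vanishes wherever `Ext_{A ⊗ B}(X ⊗ L, Y ⊗ L)` does
(`subsingleton_ext_of_split_unit`). This yields the conditions on `Ext` and on injective dimension.
Restricted to `A`, the module `T ⊗ L` is a finite power of `T`, and `D(A) ⊗ D(B)` has `D(A)` as a
direct summand; hence the resolution of `D(A ⊗ B)` gives one of `D(A)`, because modules with an
`add(T)`-resolution of bounded length are closed under finite-dimensional summands
(`AddResolution.of_retract`). The other factor is symmetric. -/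

namespace ExtTensor

/-! ### External tensor products of modules and of linear maps -/

section Basic

variable {k A B T L : Type*} [Field k] [Ring A] [Ring B] [Algebra k A] [Algebra k B]
  [AddCommGroup T] [AddCommGroup L] [Module k T] [Module k L]

/-- The pure tensor `t ⊗ l` in `ExtTensor k T L`. -/
def tmul (k : Type*) [Field k] {T L : Type*} [AddCommGroup T] [AddCommGroup L]
    [Module k T] [Module k L] (t : T) (l : L) : ExtTensor k T L :=
  (t ⊗ₜ[k] l : T ⊗[k] L)

theorem tmul_add (t : T) (l l' : L) : tmul k t (l + l') = tmul k t l + tmul k t l' :=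
  TensorProduct.tmul_add t l l'

theorem add_tmul (t t' : T) (l : L) : tmul k (t + t') l = tmul k t l + tmul k t' l :=
  TensorProduct.add_tmul t t' l

theorem induction_on {motive : ExtTensor k T L → Prop} (v : ExtTensor k T L)
    (zero : motive 0) (tmul : ∀ t l, motive (tmul k t l))
    (add : ∀ v w, motive v → motive w → motive (v + w)) : motive v :=
  TensorProduct.induction_on (motive := motive) v zero tmul add

variable [Module A T] [Module B L] [IsScalarTower k A T] [IsScalarTower k B L]

theorem smul_tmul_tmul (a : A) (b : B) (t : T) (l : L) :
    (a ⊗ₜ[k] b) • tmul k t l = tmul k (a • t) (b • l) := rfl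

/-- An additive map out of `T ⊗ L` compatible with pure tensors is `A ⊗ B`-linear. -/
def lift {W : Type*} [AddCommGroup W] [Module (A ⊗[k] B) W] (φ : T ⊗[k] L →+ W)
    (h : ∀ (a : A) (b : B) (t : T) (l : L),
      φ ((a • t) ⊗ₜ (b • l)) = (a ⊗ₜ[k] b) • φ (t ⊗ₜ l)) :
    ExtTensor k T L →ₗ[A ⊗[k] B] W where
  toFun v := φ v
  map_add' v w := φ.map_add v w
  map_smul' c v := by
    let ψ : ExtTensor k T L →+ W := φ
    change ψ (c • v) = c • ψ v
    induction c with
    | zero => rw [zero_smul, zero_smul, map_zero]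
    | add x y hx hy => rw [add_smul, add_smul, map_add, hx, hy]
    | tmul a b =>
      refine induction_on (motive := fun v => ψ ((a ⊗ₜ[k] b) • v) = (a ⊗ₜ[k] b) • ψ v) v ?_ ?_ ?_
      · rw [smul_zero, map_zero, smul_zero]
      · exact fun t l => h a b t l
      · intro v w hv hw
        rw [smul_add, map_add, hv, hw, map_add, smul_add]

theorem hom_ext {W : Type*} [AddCommGroup W] [Module (A ⊗[k] B) W]
    {f g : ExtTensor k T L →ₗ[A ⊗[k] B] W}
    (h : ∀ t l, f (tmul k t l) = g (tmul k t l)) : f = g := by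
  ext v
  refine induction_on (motive := fun v => f v = g v) v (by rw [map_zero, map_zero]) h ?_
  intro v w hv hw
  rw [map_add, map_add, hv, hw]

end Basic

section Map

variable (k : Type*) {A B T L T' L' T'' L'' : Type*} [Field k] [Ring A] [Ring B] [Algebra k A]
  [Algebra k B] [AddCommGroup T] [AddCommGroup L] [Module k T] [Module k L]
  [Module A T] [Module B L] [IsScalarTower k A T] [IsScalarTower k B L]
  [AddCommGroup T'] [AddCommGroup L'] [Module k T'] [Module k L']
  [Module A T'] [Module B L'] [IsScalarTower k A T'] [IsScalarTower k B L']
  [AddCommGroup T''] [AddCommGroup L''] [Module k T''] [Module k L'']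
  [Module A T''] [Module B L''] [IsScalarTower k A T''] [IsScalarTower k B L'']

/-- The `A ⊗ B`-linear map `f ⊗ g`. -/
noncomputable def map (f : T →ₗ[A] T') (g : L →ₗ[B] L') :
    ExtTensor k T L →ₗ[A ⊗[k] B] ExtTensor k T' L' :=
  lift (TensorProduct.map (f.restrictScalars k) (g.restrictScalars k)).toAddMonoidHom
    (fun a b t l => by
      change tmul k (f (a • t)) (g (b • l)) = (a ⊗ₜ[k] b) • tmul k (f t) (g l)
      rw [smul_tmul_tmul, map_smul, map_smul])

@[simp]
theorem map_tmul (f : T →ₗ[A] T') (g : L →ₗ[B] L') (t : T) (l : L) :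
    map k f g (tmul k t l) = tmul k (f t) (g l) := rfl

theorem map_id_id : map k (LinearMap.id : T →ₗ[A] T) (LinearMap.id : L →ₗ[B] L) =
    LinearMap.id :=
  hom_ext fun _ _ => rfl

theorem map_comp_map (f : T →ₗ[A] T') (g : L →ₗ[B] L') (f' : T' →ₗ[A] T'') (g' : L' →ₗ[B] L'') :
    map k f' g' ∘ₗ map k f g = map k (f' ∘ₗ f) (g' ∘ₗ g) :=
  hom_ext fun _ _ => rfl

theorem map_add_left (f f' : T →ₗ[A] T') (g : L →ₗ[B] L') :
    map k (f + f') g = map k f g + map k f' g :=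
  hom_ext fun _ _ => by simp [add_tmul]

theorem map_add_right (f : T →ₗ[A] T') (g g' : L →ₗ[B] L') :
    map k f (g + g') = map k f g + map k f g' :=
  hom_ext fun _ _ => by simp [tmul_add]

theorem map_sum_left {ι : Type*} (s : Finset ι) (f : ι → T →ₗ[A] T') (g : L →ₗ[B] L') :
    map k (∑ i ∈ s, f i) g = ∑ i ∈ s, map k (f i) g :=
  map_sum (AddMonoidHom.mk' (fun f : T →ₗ[A] T' => map k f g)
    fun f f' => map_add_left k f f' g) f s

theorem map_sum_right {ι : Type*} (s : Finset ι) (f : T →ₗ[A] T') (g : ι → L →ₗ[B] L') :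
    map k f (∑ i ∈ s, g i) = ∑ i ∈ s, map k f (g i) :=
  map_sum (AddMonoidHom.mk' (fun g : L →ₗ[B] L' => map k f g)
    fun g g' => map_add_right k f g g') g s

variable (L) in
theorem map_id_right_injective {f : T →ₗ[A] T'} (hf : Function.Injective f) :
    Function.Injective (map k f (LinearMap.id : L →ₗ[B] L)) :=
  Module.Flat.rTensor_preserves_injective_linearMap (M := L) (f.restrictScalars k) hf

variable (L) in
theorem map_id_right_surjective {f : T →ₗ[A] T'} (hf : Function.Surjective f) :
    Function.Surjective (map k f (LinearMap.id : L →ₗ[B] L)) :=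
  LinearMap.rTensor_surjective L (g := f.restrictScalars k) hf

variable (L) in
theorem map_id_right_exact {f : T →ₗ[A] T'} {g : T' →ₗ[A] T''} (h : Function.Exact f g) :
    Function.Exact (map k f (LinearMap.id : L →ₗ[B] L)) (map k g (LinearMap.id : L →ₗ[B] L)) :=
  Module.Flat.rTensor_exact L (f := f.restrictScalars k) (g := g.restrictScalars k) h

variable (T) in
theorem map_id_left_injective {f : L →ₗ[B] L'} (hf : Function.Injective f) :
    Function.Injective (map k (LinearMap.id : T →ₗ[A] T) f) :=
  Module.Flat.lTensor_preserves_injective_linearMap (M := T) (f.restrictScalars k) hf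

variable (T) in
theorem map_id_left_surjective {f : L →ₗ[B] L'} (hf : Function.Surjective f) :
    Function.Surjective (map k (LinearMap.id : T →ₗ[A] T) f) :=
  LinearMap.lTensor_surjective T (g := f.restrictScalars k) hf

variable (T) in
theorem map_id_left_exact {f : L →ₗ[B] L'} {g : L' →ₗ[B] L''} (h : Function.Exact f g) :
    Function.Exact (map k (LinearMap.id : T →ₗ[A] T) f) (map k (LinearMap.id : T →ₗ[A] T) g) :=
  Module.Flat.lTensor_exact T (f := f.restrictScalars k) (g := g.restrictScalars k) h

end Map

end ExtTensor

/-! ### Summands of finite powers -/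

section InAdd

variable {A T X Y S : Type*} [Ring A] [AddCommGroup T] [Module A T] [AddCommGroup X] [Module A X]
  [AddCommGroup Y] [Module A Y] [AddCommGroup S] [Module A S]

/-- Membership in `add(T)` amounts to a decomposition of the identity into endomorphisms factoring
through `T`. In this form additive constructions, such as `Ext` and the external tensor product, can
be applied term by term. -/
theorem inAdd_of_sum_eq_id {ι : Type*} [Fintype ι] (i : ι → X →ₗ[A] T) (p : ι → T →ₗ[A] X)
    (h : ∑ j, p j ∘ₗ i j = LinearMap.id) : InAdd A T X := by
  let e := Fintype.equivFin ι
  refine ⟨Fintype.card ι, LinearMap.pi fun j => i (e.symm j),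
    ∑ j, p (e.symm j) ∘ₗ LinearMap.proj j, ?_⟩
  rw [← h, ← e.symm.sum_comp]
  ext x
  simp

theorem InAdd.exists_sum_eq_id (h : InAdd A T X) :
    ∃ (n : ℕ) (i : Fin n → X →ₗ[A] T) (p : Fin n → T →ₗ[A] X),
      ∑ j, p j ∘ₗ i j = LinearMap.id := by
  obtain ⟨n, i, p, h⟩ := h
  refine ⟨n, fun j => LinearMap.proj j ∘ₗ i, fun j => p ∘ₗ LinearMap.single A (fun _ => T) j, ?_⟩
  rw [← h]
  ext x
  simp only [LinearMap.sum_apply, LinearMap.comp_apply, LinearMap.proj_apply, ← map_sum]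
  congr 1
  exact LinearMap.sum_single_apply _ (i x)

theorem InAdd.self : InAdd A T T :=
  inAdd_of_sum_eq_id (ι := Unit) (fun _ => LinearMap.id) (fun _ => LinearMap.id) (by ext; simp)

theorem InAdd.of_retract (h : InAdd A T X) (i : Y →ₗ[A] X) (p : X →ₗ[A] Y)
    (hip : p ∘ₗ i = LinearMap.id) : InAdd A T Y := by
  obtain ⟨n, i', p', h⟩ := h
  refine ⟨n, i' ∘ₗ i, p ∘ₗ p', ?_⟩
  rw [← hip]
  ext y
  simp [← LinearMap.comp_apply p' i', h]

theorem InAdd.of_equiv (h : InAdd A T X) (e : X ≃ₗ[A] Y) : InAdd A T Y :=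
  h.of_retract e.symm.toLinearMap e.toLinearMap (by ext; simp)

theorem InAdd.of_subsingleton [Subsingleton X] : InAdd A T X :=
  ⟨0, 0, 0, by ext x; exact Subsingleton.elim _ _⟩

theorem InAdd.pi (n : ℕ) : InAdd A T (Fin n → T) :=
  ⟨n, LinearMap.id, LinearMap.id, rfl⟩

theorem InAdd.trans (h : InAdd A T X) (h' : InAdd A S T) : InAdd A S X := by
  obtain ⟨n, i, p, h⟩ := h.exists_sum_eq_id
  obtain ⟨m, j, q, h'⟩ := h'.exists_sum_eq_id
  refine inAdd_of_sum_eq_id (ι := Fin n × Fin m) (fun c => j c.2 ∘ₗ i c.1)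
    (fun c => p c.1 ∘ₗ q c.2) ?_
  rw [← h, Fintype.sum_prod_type]
  refine Finset.sum_congr rfl fun c _ => ?_
  ext x
  simp only [LinearMap.sum_apply, LinearMap.comp_apply, ← map_sum]
  congr 1
  simpa using LinearMap.congr_fun h' (i c x)

theorem InAdd.prod (h : InAdd A T X) (h' : InAdd A T Y) : InAdd A T (X × Y) := by
  obtain ⟨n, i, p, h⟩ := h.exists_sum_eq_id
  obtain ⟨m, j, q, h'⟩ := h'.exists_sum_eq_id
  refine inAdd_of_sum_eq_id (ι := Fin n ⊕ Fin m)
    (Sum.elim (fun c => i c ∘ₗ LinearMap.fst A X Y) (fun c => j c ∘ₗ LinearMap.snd A X Y))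
    (Sum.elim (fun c => LinearMap.inl A X Y ∘ₗ p c) (fun c => LinearMap.inr A X Y ∘ₗ q c)) ?_
  rw [Fintype.sum_sum_type]
  refine LinearMap.ext fun x => ?_
  have h1 := LinearMap.congr_fun h x.1
  have h2 := LinearMap.congr_fun h' x.2
  simp only [LinearMap.sum_apply, LinearMap.comp_apply, LinearMap.id_apply] at h1 h2
  simp only [Sum.elim_inl, Sum.elim_inr, LinearMap.add_apply, LinearMap.sum_apply,
    LinearMap.comp_apply, LinearMap.fst_apply, LinearMap.snd_apply, ← map_sum, h1, h2]
  simp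

theorem InAdd.extTensor {k A B T L X Z : Type*} [Field k] [Ring A] [Ring B] [Algebra k A]
    [Algebra k B] [AddCommGroup T] [AddCommGroup L] [Module k T] [Module k L]
    [Module A T] [Module B L] [IsScalarTower k A T] [IsScalarTower k B L]
    [AddCommGroup X] [AddCommGroup Z] [Module k X] [Module k Z]
    [Module A X] [Module B Z] [IsScalarTower k A X] [IsScalarTower k B Z]
    (h : InAdd A T X) (h' : InAdd B L Z) :
    InAdd (A ⊗[k] B) (ExtTensor k T L) (ExtTensor k X Z) := by
  obtain ⟨n, i, p, h⟩ := h.exists_sum_eq_id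
  obtain ⟨m, j, q, h'⟩ := h'.exists_sum_eq_id
  refine inAdd_of_sum_eq_id (ι := Fin n × Fin m) (fun c => ExtTensor.map k (i c.1) (j c.2))
    (fun c => ExtTensor.map k (p c.1) (q c.2)) ?_
  rw [Fintype.sum_prod_type, ← ExtTensor.map_id_id, ← h, ← h', ExtTensor.map_sum_left]
  simp only [ExtTensor.map_sum_right, ExtTensor.map_comp_map]

end InAdd

/-! ### Duals of regular modules -/

section Dual

variable (k A B : Type*) [Field k] [Ring A] [Ring B] [Algebra k A] [Algebra k B]

noncomputable instance : Module k (DualRegular k A) :=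
  inferInstanceAs (Module k (A →ₗ[k] k))

variable {k A} in
theorem DualRegular.smul_apply (a : A) (f : DualRegular k A) (x : A) :
    (show A →ₗ[k] k from a • f) x = (show A →ₗ[k] k from f) (x * a) := rfl

instance : IsScalarTower k A (DualRegular k A) where
  smul_assoc c a f := LinearMap.ext fun x => by
    rw [DualRegular.smul_apply, mul_smul_comm, map_smul]
    rfl

instance [Module.Finite k A] : Module.Finite k (DualRegular k A) :=
  inferInstanceAs (Module.Finite k (Module.Dual k A))

/-- The canonical map `D(A) ⊗ D(B) → D(A ⊗ B)` of `A ⊗ B`-modules. -/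
noncomputable def dualRegularTensorHom :
    ExtTensor k (DualRegular k A) (DualRegular k B) →ₗ[A ⊗[k] B] DualRegular k (A ⊗[k] B) :=
  ExtTensor.lift
    (show DualRegular k A ⊗[k] DualRegular k B →+ DualRegular k (A ⊗[k] B) from
      (TensorProduct.dualDistrib k A B).toAddMonoidHom)
    (fun a b f g => TensorProduct.ext' (M := A) (N := B) (P₂ := k) fun x y => by
      rw [DualRegular.smul_apply, Algebra.TensorProduct.tmul_mul_tmul]
      change TensorProduct.dualDistrib k A B (_ ⊗ₜ[k] _) _ =
        TensorProduct.dualDistrib k A B (_ ⊗ₜ[k] _) _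
      exact (TensorProduct.dualDistrib_apply (R := k) (M := A) (N := B) _ _ _ _).trans
        (TensorProduct.dualDistrib_apply (R := k) (M := A) (N := B) _ _ _ _).symm)

/-- `D(A) ⊗ D(B) ≅ D(A ⊗ B)` as `A ⊗ B`-modules. -/
noncomputable def dualRegularTensorEquiv [Module.Finite k A] [Module.Finite k B] :
    ExtTensor k (DualRegular k A) (DualRegular k B) ≃ₗ[A ⊗[k] B] DualRegular k (A ⊗[k] B) :=
  LinearEquiv.ofBijective (dualRegularTensorHom k A B)
    (show Function.Bijective (TensorProduct.dualDistrib k A B) from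
      (TensorProduct.dualDistribEquiv k A B).bijective)

/-- The external tensor product of the regular modules is the regular module. -/
noncomputable def regularTensorEquiv : ExtTensor k A B ≃ₗ[A ⊗[k] B] (A ⊗[k] B) :=
  LinearEquiv.ofBijective
    (ExtTensor.lift (T := A) (L := B) (W := A ⊗[k] B) (AddMonoidHom.id _) (fun a b t l => by simp))
    Function.bijective_id

end Dual

/-! ### Homomorphisms between external tensor products -/

section HomTensor

variable (k : Type*) {A B X M Y N : Type*} [Field k] [Ring A] [Ring B] [Algebra k A]
  [Algebra k B] [AddCommGroup X] [AddCommGroup M] [Module k X] [Module k M]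
  [Module A X] [Module B M] [IsScalarTower k A X] [IsScalarTower k B M]
  [AddCommGroup Y] [AddCommGroup N] [Module k Y] [Module k N]
  [Module A Y] [Module B N] [IsScalarTower k A Y] [IsScalarTower k B N]

namespace ExtTensor

variable (Y) in
/-- The contraction `y ⊗ n ↦ φ n • y` of the second factor. -/
noncomputable def contract (φ : N →ₗ[k] k) : ExtTensor k Y N →ₗ[k] Y :=
  (TensorProduct.rid k Y).toLinearMap ∘ₗ LinearMap.lTensor Y φ

@[simp]
theorem contract_tmul (φ : N →ₗ[k] k) (y : Y) (n : N) :
    contract k Y φ (tmul k y n) = φ n • y := by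
  change TensorProduct.rid k Y (LinearMap.lTensor Y φ (y ⊗ₜ[k] n)) = φ n • y
  simp

theorem contract_smul (φ : N →ₗ[k] k) (a : A) (v : ExtTensor k Y N) :
    contract k Y φ ((a ⊗ₜ[k] (1 : B)) • v) = a • contract k Y φ v := by
  refine induction_on (motive := fun v => contract k Y φ ((a ⊗ₜ[k] (1 : B)) • v) =
    a • contract k Y φ v) v ?_ ?_ ?_
  · rw [smul_zero, map_zero, smul_zero]
  · intro y n
    rw [smul_tmul_tmul, contract_tmul, contract_tmul, one_smul, smul_comm]
  · intro v w hv hw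
    rw [smul_add, map_add, hv, hw, map_add, smul_add]

variable (N) in
/-- The contraction `y ⊗ n ↦ φ y • n` of the first factor. -/
noncomputable def contractLeft (φ : Y →ₗ[k] k) : ExtTensor k Y N →ₗ[k] N :=
  (TensorProduct.lid k N).toLinearMap ∘ₗ LinearMap.rTensor N φ

@[simp]
theorem contractLeft_tmul (φ : Y →ₗ[k] k) (y : Y) (n : N) :
    contractLeft k N φ (tmul k y n) = φ y • n := by
  change TensorProduct.lid k N (LinearMap.rTensor N φ (y ⊗ₜ[k] n)) = φ y • n
  simp

theorem contractLeft_smul (φ : Y →ₗ[k] k) (b : B) (v : ExtTensor k Y N) :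
    contractLeft k N φ (((1 : A) ⊗ₜ[k] b) • v) = b • contractLeft k N φ v := by
  refine induction_on (motive := fun v => contractLeft k N φ (((1 : A) ⊗ₜ[k] b) • v) =
    b • contractLeft k N φ v) v ?_ ?_ ?_
  · rw [smul_zero, map_zero, smul_zero]
  · intro y n
    rw [smul_tmul_tmul, contractLeft_tmul, contractLeft_tmul, one_smul, smul_comm]
  · intro v w hv hw
    rw [smul_add, map_add, hv, hw, map_add, smul_add]

theorem smul_tmul (c : k) (t : X) (l : M) : tmul k (c • t) l = tmul k t (c • l) :=
  TensorProduct.smul_tmul c t l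

theorem tmul_sum {ι : Type*} (s : Finset ι) (t : X) (l : ι → M) :
    tmul k t (∑ i ∈ s, l i) = ∑ i ∈ s, tmul k t (l i) :=
  TensorProduct.tmul_sum t s l

theorem sum_tmul {ι : Type*} (s : Finset ι) (t : ι → X) (l : M) :
    tmul k (∑ i ∈ s, t i) l = ∑ i ∈ s, tmul k (t i) l :=
  TensorProduct.sum_tmul s t l

/-- A basis of `N` identifies `Y ⊗ N` with a finite power of `Y`; the contractions are the
projections of that power. -/
theorem sum_contract_tmul_basis {ι : Type*} [Fintype ι] (b : Module.Basis ι k N)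
    (v : ExtTensor k Y N) : ∑ i, tmul k (contract k Y (b.coord i) v) (b i) = v := by
  refine induction_on (motive := fun v => ∑ i, tmul k (contract k Y (b.coord i) v) (b i) = v)
    v ?_ ?_ ?_
  · refine Finset.sum_eq_zero fun i _ => ?_
    rw [map_zero]
    exact TensorProduct.zero_tmul _ _
  · intro y n
    simp only [contract_tmul, smul_tmul]
    rw [← tmul_sum]
    simp [b.sum_repr]
  · intro v w hv hw
    simp only [map_add, add_tmul, Finset.sum_add_distrib, hv, hw]

theorem sum_contractLeft_tmul_basis {ι : Type*} [Fintype ι] (b : Module.Basis ι k Y)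
    (v : ExtTensor k Y N) : ∑ i, tmul k (b i) (contractLeft k N (b.coord i) v) = v := by
  refine induction_on (motive := fun v => ∑ i, tmul k (b i) (contractLeft k N (b.coord i) v) = v)
    v ?_ ?_ ?_
  · refine Finset.sum_eq_zero fun i _ => ?_
    rw [map_zero]
    exact TensorProduct.tmul_zero _ _
  · intro y n
    simp only [contractLeft_tmul, ← smul_tmul]
    rw [← sum_tmul]
    simp [b.sum_repr]
  · intro v w hv hw
    simp only [map_add, tmul_add, Finset.sum_add_distrib, hv, hw]

-- Contracting with a functional `φ` turns the hypothesis into a linear relation among the `u i`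
-- with coefficients `φ (z i)`, and functionals separate the points of `N`.
omit [Module k X] [IsScalarTower k A X] in
theorem eq_zero_of_sum_tmul_eq_zero {ι : Type*} [Fintype ι] {u : ι → X →ₗ[A] Y}
    (hu : LinearIndependent k u) (z : ι → N) (h : ∀ x, ∑ i, tmul k (u i x) (z i) = 0) (i : ι) :
    z i = 0 := by
  rw [← Module.forall_dual_apply_eq_zero_iff k]
  intro φ
  refine Fintype.linearIndependent_iff.1 hu (fun j => φ (z j)) ?_ i
  ext x
  have := congrArg (contract k Y φ) (h x)
  simpa using this

/-- For `f : X ⊗ M → Y ⊗ N`, the `A`-linear map `x ↦ (1 ⊗ φ) (f (x ⊗ m))`. -/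
noncomputable def slice (f : ExtTensor k X M →ₗ[A ⊗[k] B] ExtTensor k Y N) (φ : N →ₗ[k] k) :
    M →ₗ[k] X →ₗ[A] Y where
  toFun m :=
    { toFun x := contract k Y φ (f (tmul k x m))
      map_add' x y := by rw [add_tmul, map_add, map_add]
      map_smul' a x := by
        have : tmul k (a • x) m = (a ⊗ₜ[k] (1 : B)) • tmul k x m := by
          rw [smul_tmul_tmul, one_smul]
        rw [this, map_smul, contract_smul, RingHom.id_apply] }
  map_add' m m' := by
    ext x
    simp [tmul_add]
  map_smul' c m := by
    ext x
    have : tmul k x (c • m) = c • tmul k x m := TensorProduct.tmul_smul c x m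
    simp [this]

theorem slice_apply (f : ExtTensor k X M →ₗ[A ⊗[k] B] ExtTensor k Y N) (φ : N →ₗ[k] k)
    (m : M) (x : X) : slice k f φ m x = contract k Y φ (f (tmul k x m)) := rfl

theorem finite_hom [Module.Finite k X] [Module.Finite k Y] : Module.Finite k (X →ₗ[A] Y) :=
  Module.Finite.of_injective (LinearMap.restrictScalarsₗ k A X Y k)
    (LinearMap.restrictScalars_injective k)

/-- Contracting `f (x ⊗ m)` with a coordinate of `N` gives an `A`-linear map in `x`, which expands
in a basis `u` of `Hom_A(X, Y)`. The coefficients, reassembled over the basis of `N`, form the maps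
`w j`. -/
theorem exists_eq_sum_map [Module.Finite k X] [Module.Finite k Y] [Module.Finite k N]
    (f : ExtTensor k X M →ₗ[A ⊗[k] B] ExtTensor k Y N) :
    ∃ (n : ℕ) (u : Fin n → X →ₗ[A] Y) (w : Fin n → M →ₗ[B] N), f = ∑ i, map k (u i) (w i) := by
  have : Module.Finite k (X →ₗ[A] Y) := finite_hom k
  let u := Module.finBasis k (X →ₗ[A] Y)
  let b := Module.finBasis k N
  let w (j) (m : M) : N := ∑ q, u.repr (slice k f (b.coord q) m) j • b q
  have hw (x : X) (m : M) : ∑ j, tmul k (u j x) (w j m) = f (tmul k x m) := by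
    rw [← sum_contract_tmul_basis k b (f (tmul k x m))]
    simp only [← slice_apply, w, tmul_sum, ← smul_tmul]
    rw [Finset.sum_comm]
    refine Finset.sum_congr rfl fun q _ => ?_
    rw [← sum_tmul]
    congr 1
    have := LinearMap.congr_fun (u.sum_repr (slice k f (b.coord q) m)) x
    rwa [LinearMap.sum_apply] at this
  have hadd (j) (m m' : M) : w j (m + m') = w j m + w j m' := by
    simp [w, add_smul, Finset.sum_add_distrib]
  -- The `B`-linearity of `w j` is forced by that of `f`, since the coefficients in front of the
  -- independent `u j` are unique.
  have hsmul (j) (c : B) (m : M) : w j (c • m) = c • w j m := by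
    rw [← sub_eq_zero]
    refine eq_zero_of_sum_tmul_eq_zero k u.linearIndependent
      (fun j => w j (c • m) - c • w j m) (fun x => ?_) j
    have e1 : ∑ j, tmul k (u j x) (c • w j m) = f (tmul k x (c • m)) := by
      have e2 : tmul k x (c • m) = ((1 : A) ⊗ₜ[k] c) • tmul k x m := by
        rw [smul_tmul_tmul, one_smul]
      rw [e2, map_smul, ← hw, Finset.smul_sum]
      simp only [smul_tmul_tmul, one_smul]
    have e3 (j) : tmul k (u j x) (w j (c • m) - c • w j m) =
        tmul k (u j x) (w j (c • m)) - tmul k (u j x) (c • w j m) :=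
      TensorProduct.tmul_sub _ _ _
    simp only [e3]
    rw [Finset.sum_sub_distrib, hw, e1, sub_self]
  refine ⟨_, u, fun j => { toFun := w j, map_add' := hadd j, map_smul' := hsmul j }, ?_⟩
  refine hom_ext fun x m => ?_
  rw [LinearMap.sum_apply, ← hw]
  rfl

variable (A B X M) in
/-- The algebra homomorphism `u ↦ u ⊗ 1`. -/
noncomputable def endLeft :
    Module.End A X →ₐ[k] Module.End (A ⊗[k] B) (ExtTensor k X M) :=
  AlgHom.ofLinearMap
    { toFun := fun u : Module.End A X => map k u (LinearMap.id : M →ₗ[B] M)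
      map_add' := fun u u' => map_add_left k u u' _
      map_smul' := fun _ _ => hom_ext fun _ _ => rfl }
    (map_id_id k) (fun _ _ => hom_ext fun _ _ => rfl)

variable (A B X M) in
/-- The algebra homomorphism `w ↦ 1 ⊗ w`. -/
noncomputable def endRight :
    Module.End B M →ₐ[k] Module.End (A ⊗[k] B) (ExtTensor k X M) :=
  AlgHom.ofLinearMap
    { toFun := fun w : Module.End B M => map k (LinearMap.id : X →ₗ[A] X) w
      map_add' := fun w w' => map_add_right k _ w w'
      map_smul' := fun c w => hom_ext fun t l => TensorProduct.tmul_smul c t (w l) }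
    (map_id_id k) (fun _ _ => hom_ext fun _ _ => rfl)

theorem endLeft_mul_endRight (u : Module.End A X) (w : Module.End B M) :
    endLeft k A B X M u * endRight k A B X M w = map k u w :=
  hom_ext fun _ _ => rfl

theorem commute_endLeft_endRight (u : Module.End A X) (w : Module.End B M) :
    Commute (endLeft k A B X M u) (endRight k A B X M w) :=
  (commute_iff_eq _ _).2 (hom_ext fun _ _ => rfl)

variable (A B X M) in
/-- The algebra homomorphism `u ⊗ w ↦ u ⊗ w` from `End_A(X) ⊗ End_B(M)` to
`End_{A ⊗ B}(X ⊗ M)`. -/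
noncomputable def endTensorHom :
    Module.End A X ⊗[k] Module.End B M →ₐ[k] Module.End (A ⊗[k] B) (ExtTensor k X M) :=
  Algebra.TensorProduct.lift (endLeft k A B X M) (endRight k A B X M)
    (commute_endLeft_endRight k)

theorem endTensorHom_tmul (u : Module.End A X) (w : Module.End B M) :
    endTensorHom k A B X M (u ⊗ₜ w) = map k u w := by
  rw [endTensorHom, Algebra.TensorProduct.lift_tmul, endLeft_mul_endRight]

theorem endTensorHom_bijective [Module.Finite k X] [Module.Finite k M] :
    Function.Bijective (endTensorHom k A B X M) := by
  have hfin : Module.Finite k (X →ₗ[A] X) := finite_hom k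
  constructor
  · rw [injective_iff_map_eq_zero]
    intro z hz
    -- An element of the kernel is expanded over a basis of the left factor; its coefficients in
    -- `End_B(M)` vanish pointwise by independence of that basis.
    let u : Module.Basis _ k (Module.End A X) := Module.finBasis k (X →ₗ[A] X)
    obtain ⟨w, rfl⟩ := TensorProduct.eq_repr_basis_left u z
    rw [Finsupp.sum_fintype _ _ (by simp)] at hz ⊢
    refine Finset.sum_eq_zero fun j _ => ?_
    suffices h : w j = 0 by rw [h, TensorProduct.tmul_zero]
    ext m
    refine eq_zero_of_sum_tmul_eq_zero k u.linearIndependent (fun j => w j m) (fun x => ?_) j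
    have := LinearMap.congr_fun hz (tmul k x m)
    simpa [endTensorHom_tmul] using this
  · intro f
    obtain ⟨n, u, w, rfl⟩ := exists_eq_sum_map k f
    exact ⟨∑ i, u i ⊗ₜ w i, by simp [endTensorHom_tmul]⟩

end ExtTensor

end HomTensor

/-! ### Dimension shifting for `Ext` -/

section ExtShift

open CategoryTheory Abelian

variable {C : Type*} [Category* C] [Abelian C] [HasExt C] {S : ShortComplex C}

/-- Since `Ext¹(X₂, Y) = 0`, each class in `Ext¹(X₃, Y)` is the extension class of `S` pushed out
along some `f : X₁ ⟶ Y`, and it dies once `f` extends to `X₂`. -/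
theorem subsingleton_ext_one_of_exists_lift (hS : S.ShortExact) (Y : C)
    (hP : Subsingleton (Ext S.X₂ Y 1)) (h : ∀ f : S.X₁ ⟶ Y, ∃ g : S.X₂ ⟶ Y, S.f ≫ g = f) :
    Subsingleton (Ext S.X₃ Y 1) := by
  refine subsingleton_of_forall_eq 0 fun e => ?_
  obtain ⟨x, rfl⟩ := Ext.contravariant_sequence_exact₃ hS Y e (Subsingleton.elim _ _) (add_zero 1)
  obtain ⟨f, rfl⟩ := Ext.mk₀_bijective _ _ |>.surjective x
  obtain ⟨g, rfl⟩ := h f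
  rw [← Ext.mk₀_comp_mk₀, hS.extClass_comp_assoc]

theorem exists_lift_of_subsingleton_ext_one (hS : S.ShortExact) (Y : C)
    (h : Subsingleton (Ext S.X₃ Y 1)) (f : S.X₁ ⟶ Y) : ∃ g : S.X₂ ⟶ Y, S.f ≫ g = f := by
  obtain ⟨x, hx⟩ := Ext.contravariant_sequence_exact₁ hS Y (Ext.mk₀ f) (add_zero 1)
    (Subsingleton.elim _ _)
  obtain ⟨g, rfl⟩ := Ext.mk₀_bijective _ _ |>.surjective x
  refine ⟨g, (Ext.mk₀_bijective _ _).injective ?_⟩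
  rw [← hx, Ext.mk₀_comp_mk₀]

theorem exists_colift_of_subsingleton_ext_one (hS : S.ShortExact) (X : C)
    (h : Subsingleton (Ext X S.X₁ 1)) (f : X ⟶ S.X₃) : ∃ g : X ⟶ S.X₂, g ≫ S.g = f := by
  obtain ⟨x, hx⟩ := Ext.covariant_sequence_exact₃ X hS (Ext.mk₀ f) (zero_add 1)
    (Subsingleton.elim _ _)
  obtain ⟨g, rfl⟩ := Ext.mk₀_bijective _ _ |>.surjective x
  refine ⟨g, (Ext.mk₀_bijective _ _).injective ?_⟩
  rw [← hx, Ext.mk₀_comp_mk₀]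

theorem subsingleton_ext_succ_X₃ (hS : S.ShortExact) (Y : C) (n : ℕ)
    (hP : Subsingleton (Ext S.X₂ Y (n + 1))) (h : Subsingleton (Ext S.X₁ Y n)) :
    Subsingleton (Ext S.X₃ Y (n + 1)) := by
  refine subsingleton_of_forall_eq 0 fun e => ?_
  obtain ⟨x, rfl⟩ := Ext.contravariant_sequence_exact₃ hS Y e (Subsingleton.elim _ _)
    (add_comm 1 n)
  rw [Subsingleton.elim x 0, Ext.comp_zero]

theorem subsingleton_ext_X₁ (hS : S.ShortExact) (Y : C) (n : ℕ)
    (hP : Subsingleton (Ext S.X₂ Y n)) (h : Subsingleton (Ext S.X₃ Y (n + 1))) :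
    Subsingleton (Ext S.X₁ Y n) := by
  refine subsingleton_of_forall_eq 0 fun e => ?_
  obtain ⟨x, rfl⟩ := Ext.contravariant_sequence_exact₁ hS Y e (add_comm 1 n)
    (Subsingleton.elim _ _)
  rw [Subsingleton.elim x 0, Ext.comp_zero]

theorem subsingleton_ext_X₃ (hS : S.ShortExact) (X : C) (n : ℕ)
    (h₂ : Subsingleton (Ext X S.X₂ n)) (h₁ : Subsingleton (Ext X S.X₁ (n + 1))) :
    Subsingleton (Ext X S.X₃ n) := by
  refine subsingleton_of_forall_eq 0 fun e => ?_
  obtain ⟨x, rfl⟩ := Ext.covariant_sequence_exact₃ X hS e rfl (Subsingleton.elim _ _)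
  rw [Subsingleton.elim x 0, Ext.zero_comp]

end ExtShift

/-! ### Extending and lifting linear maps when `Ext¹` vanishes -/

section ModuleShortExact

variable {A X Y Z : Type u} [Ring A] [AddCommGroup X] [Module A X] [AddCommGroup Y] [Module A Y]
  [AddCommGroup Z] [Module A Z]

/-- The short complex of modules attached to an exact pair of linear maps. -/
abbrev exactPair (f : X →ₗ[A] Y) (g : Y →ₗ[A] Z) (h : Function.Exact f g) :
    CategoryTheory.ShortComplex (ModuleCat.{u} A) :=
  CategoryTheory.ShortComplex.moduleCatMk f g h.linearMap_comp_eq_zero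

theorem exactPair_shortExact {f : X →ₗ[A] Y} {g : Y →ₗ[A] Z} (h : Function.Exact f g)
    (hf : Function.Injective f) (hg : Function.Surjective g) : (exactPair f g h).ShortExact :=
  ModuleCat.shortComplex_shortExact _ h hf hg

theorem exists_extension_of_subsingleton_ext_one {f : X →ₗ[A] Y} {g : Y →ₗ[A] Z}
    (h : Function.Exact f g) (hf : Function.Injective f) (hg : Function.Surjective g)
    {W : Type u} [AddCommGroup W] [Module A W]
    (hext : Subsingleton (CategoryTheory.Abelian.Ext (ModuleCat.of A Z) (ModuleCat.of A W) 1))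
    (u : X →ₗ[A] W) : ∃ v : Y →ₗ[A] W, v ∘ₗ f = u := by
  obtain ⟨v, hv⟩ := exists_lift_of_subsingleton_ext_one (exactPair_shortExact h hf hg) _ hext
    (ModuleCat.ofHom u)
  exact ⟨v.hom, congrArg ModuleCat.Hom.hom hv⟩

theorem exists_lift_of_subsingleton_ext_one_ker {f : X →ₗ[A] Y} {g : Y →ₗ[A] Z}
    (h : Function.Exact f g) (hf : Function.Injective f) (hg : Function.Surjective g)
    {W : Type u} [AddCommGroup W] [Module A W]
    (hext : Subsingleton (CategoryTheory.Abelian.Ext (ModuleCat.of A W) (ModuleCat.of A X) 1))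
    (u : W →ₗ[A] Z) : ∃ v : W →ₗ[A] Y, g ∘ₗ v = u := by
  obtain ⟨v, hv⟩ := exists_colift_of_subsingleton_ext_one (exactPair_shortExact h hf hg) _ hext
    (ModuleCat.ofHom u)
  exact ⟨v.hom, congrArg ModuleCat.Hom.hom hv⟩

end ModuleShortExact

/-! ### `Ext` and injective dimension on `add(T)` -/

section InAddExt

open CategoryTheory Abelian

variable {A T X : Type u} [Ring A] [AddCommGroup T] [Module A T] [AddCommGroup X] [Module A X]

theorem hasInjectiveDimensionLE_mono {Y : ModuleCat.{u} A} {n m : ℕ}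
    (h : HasInjectiveDimensionLE Y n) (hnm : n ≤ m) : HasInjectiveDimensionLE Y m :=
  hasInjectiveDimensionLT_of_ge Y (n + 1) (m + 1) (by omega)

theorem InAdd.exists_sum_comp_eq_id (h : InAdd A T X) :
    ∃ (n : ℕ) (i : Fin n → (ModuleCat.of A X ⟶ ModuleCat.of A T))
      (p : Fin n → (ModuleCat.of A T ⟶ ModuleCat.of A X)), ∑ j, i j ≫ p j = 𝟙 _ := by
  obtain ⟨n, i, p, h⟩ := h.exists_sum_eq_id
  refine ⟨n, fun j => ModuleCat.ofHom (i j), fun j => ModuleCat.ofHom (p j), ?_⟩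
  ext x
  simpa [ModuleCat.hom_sum] using LinearMap.congr_fun h x

theorem InAdd.subsingleton_ext_right (h : InAdd A T X) (Y : ModuleCat.{u} A) (n : ℕ)
    (hT : Subsingleton (Ext Y (ModuleCat.of A T) n)) :
    Subsingleton (Ext Y (ModuleCat.of A X) n) := by
  obtain ⟨m, i, p, h⟩ := h.exists_sum_comp_eq_id
  refine subsingleton_of_forall_eq 0 fun e => ?_
  rw [← Ext.comp_mk₀_id e, ← h, Ext.mk₀_sum, Ext.comp_sum]
  refine Finset.sum_eq_zero fun j _ => ?_
  rw [← Ext.mk₀_comp_mk₀, ← Ext.comp_assoc_of_second_deg_zero,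
    Subsingleton.elim (e.comp (Ext.mk₀ (i j)) (add_zero n)) 0, Ext.zero_comp]

theorem InAdd.subsingleton_ext_left (h : InAdd A T X) (Y : ModuleCat.{u} A) (n : ℕ)
    (hT : Subsingleton (Ext (ModuleCat.of A T) Y n)) :
    Subsingleton (Ext (ModuleCat.of A X) Y n) := by
  obtain ⟨m, i, p, h⟩ := h.exists_sum_comp_eq_id
  refine subsingleton_of_forall_eq 0 fun e => ?_
  rw [← Ext.mk₀_id_comp e, ← h, Ext.mk₀_sum, Ext.sum_comp]
  refine Finset.sum_eq_zero fun j _ => ?_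
  rw [← Ext.mk₀_comp_mk₀_assoc,
    Subsingleton.elim ((Ext.mk₀ (p j)).comp e (zero_add n)) 0, Ext.comp_zero]

theorem InAdd.hasInjectiveDimensionLE (h : InAdd A T X) (n : ℕ)
    (hT : HasInjectiveDimensionLE (ModuleCat.of A T) n) :
    HasInjectiveDimensionLE (ModuleCat.of A X) n := by
  refine (hasInjectiveDimensionLT_iff _ _).2 fun i hi Y e => ?_
  have := h.subsingleton_ext_right Y i
    (HasInjectiveDimensionLT.subsingleton (ModuleCat.of A T) (n + 1) i hi Y)
  exact Subsingleton.elim _ _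

end InAddExt

section Finiteness

variable (k : Type*) {A X : Type*} [Field k] [Ring A] [Algebra k A] [AddCommGroup X] [Module k X]
  [Module A X] [IsScalarTower k A X] [Module.Finite k X]

theorem Submodule.finite_of_isScalarTower (K : Submodule A X) : Module.Finite k K :=
  Module.Finite.of_injective (K.subtype.restrictScalars k) K.subtype_injective

theorem Submodule.finite_quotient_of_isScalarTower (K : Submodule A X) : Module.Finite k (X ⧸ K) :=
  Module.Finite.of_surjective (K.mkQ.restrictScalars k) K.mkQ_surjective

end Finiteness

/-! ### Vanishing of `Ext` for external tensor products -/

section ForwardExt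

open CategoryTheory Abelian

variable (k : Type u) {A B X M Y N : Type u} [Field k] [Ring A] [Ring B] [Algebra k A]
  [Algebra k B] [AddCommGroup X] [AddCommGroup M] [Module k X] [Module k M]
  [Module A X] [Module B M] [IsScalarTower k A X] [IsScalarTower k B M]
  [AddCommGroup Y] [AddCommGroup N] [Module k Y] [Module k N]
  [Module A Y] [Module B N] [IsScalarTower k A Y] [IsScalarTower k B N]
  [Module.Finite k X] [Module.Finite k M] [Module.Finite k Y] [Module.Finite k N]

-- Induction along the syzygies of `X`, tensored with `M`. In degree one a map out of `ker g ⊗ M` is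
-- a sum of `v ⊗ w`, and each `v` extends to the free cover because `Ext¹_A(X, Y) = 0`.
omit [Module.Finite k M] in
theorem subsingleton_ext_extTensor_of_left [Module.Finite k A]
    (hfree : ∀ r n : ℕ, 1 ≤ n → Subsingleton
      (Ext (ModuleCat.of (A ⊗[k] B) (ExtTensor k (Fin r → A) M))
        (ModuleCat.of (A ⊗[k] B) (ExtTensor k Y N)) n))
    (hX : ∀ n : ℕ, 1 ≤ n → Subsingleton (Ext (ModuleCat.of A X) (ModuleCat.of A Y) n))
    (n : ℕ) (hn : 1 ≤ n) :
    Subsingleton (Ext (ModuleCat.of (A ⊗[k] B) (ExtTensor k X M))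
      (ModuleCat.of (A ⊗[k] B) (ExtTensor k Y N)) n) := by
  induction n generalizing X with
  | zero => omega
  | succ n ih =>
    have : Module.Finite A X := Module.Finite.of_restrictScalars_finite k A X
    obtain ⟨r, g, hg⟩ := Module.Finite.exists_fin' A X
    have := Submodule.finite_of_isScalarTower k (LinearMap.ker g)
    have hex : Function.Exact (LinearMap.ker g).subtype g := LinearMap.exact_subtype_ker_map g
    have hinj := (LinearMap.ker g).subtype_injective
    have hS := exactPair_shortExact hex hinj hg
    have hS' := exactPair_shortExact (ExtTensor.map_id_right_exact (B := B) k M hex)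
      (ExtTensor.map_id_right_injective k M hinj) (ExtTensor.map_id_right_surjective k M hg)
    by_cases hn' : 1 ≤ n
    · refine subsingleton_ext_succ_X₃ hS' _ n (hfree r _ hn) (ih (fun m hm => ?_) hn')
      exact subsingleton_ext_X₁ hS _ m
        (subsingleton_of_forall_eq 0 fun e => by
          obtain ⟨m, rfl⟩ := Nat.exists_eq_add_of_le' hm
          have : Projective (ModuleCat.of A (Fin r → A)) :=
            ModuleCat.projective_of_free (Pi.basisFun A (Fin r))
          exact Ext.eq_zero_of_projective (P := ModuleCat.of A (Fin r → A)) e) (hX (m + 1) (by omega))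
    · obtain rfl : n = 0 := by omega
      refine subsingleton_ext_one_of_exists_lift hS' _ (hfree r 1 le_rfl) fun f => ?_
      obtain ⟨m, v, w, hvw⟩ := ExtTensor.exists_eq_sum_map k f.hom
      choose v' hv' using fun j =>
        exists_extension_of_subsingleton_ext_one hex hinj hg (hX 1 le_rfl) (v j)
      refine ⟨ModuleCat.ofHom (∑ j, ExtTensor.map k (v' j) (w j)), ModuleCat.hom_ext ?_⟩
      rw [hvw]
      refine ExtTensor.hom_ext fun x y => ?_
      change (∑ j, ExtTensor.map k (v' j) (w j)) (ExtTensor.tmul k x.1 y) = _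
      simp only [LinearMap.sum_apply, ExtTensor.map_tmul, ← hv', LinearMap.comp_apply,
        Submodule.subtype_apply]

theorem subsingleton_ext_extTensor_of_right [Module.Finite k B]
    (hfree : ∀ r n : ℕ, 1 ≤ n → Subsingleton
      (Ext (ModuleCat.of (A ⊗[k] B) (ExtTensor k X (Fin r → B)))
        (ModuleCat.of (A ⊗[k] B) (ExtTensor k Y N)) n))
    (hM : ∀ n : ℕ, 1 ≤ n → Subsingleton (Ext (ModuleCat.of B M) (ModuleCat.of B N) n))
    (n : ℕ) (hn : 1 ≤ n) :
    Subsingleton (Ext (ModuleCat.of (A ⊗[k] B) (ExtTensor k X M))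
      (ModuleCat.of (A ⊗[k] B) (ExtTensor k Y N)) n) := by
  induction n generalizing M with
  | zero => omega
  | succ n ih =>
    have : Module.Finite B M := Module.Finite.of_restrictScalars_finite k B M
    obtain ⟨r, g, hg⟩ := Module.Finite.exists_fin' B M
    have := Submodule.finite_of_isScalarTower k (LinearMap.ker g)
    have hex : Function.Exact (LinearMap.ker g).subtype g := LinearMap.exact_subtype_ker_map g
    have hinj := (LinearMap.ker g).subtype_injective
    have hS := exactPair_shortExact hex hinj hg
    have hS' := exactPair_shortExact (ExtTensor.map_id_left_exact (A := A) k X hex)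
      (ExtTensor.map_id_left_injective k X hinj) (ExtTensor.map_id_left_surjective k X hg)
    by_cases hn' : 1 ≤ n
    · refine subsingleton_ext_succ_X₃ hS' _ n (hfree r _ hn) (ih (fun m hm => ?_) hn')
      exact subsingleton_ext_X₁ hS _ m
        (subsingleton_of_forall_eq 0 fun e => by
          obtain ⟨m, rfl⟩ := Nat.exists_eq_add_of_le' hm
          have : Projective (ModuleCat.of B (Fin r → B)) :=
            ModuleCat.projective_of_free (Pi.basisFun B (Fin r))
          exact Ext.eq_zero_of_projective (P := ModuleCat.of B (Fin r → B)) e) (hM (m + 1) (by omega))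
    · obtain rfl : n = 0 := by omega
      refine subsingleton_ext_one_of_exists_lift hS' _ (hfree r 1 le_rfl) fun f => ?_
      obtain ⟨m, v, w, hvw⟩ := ExtTensor.exists_eq_sum_map k f.hom
      choose w' hw' using fun j =>
        exists_extension_of_subsingleton_ext_one hex hinj hg (hM 1 le_rfl) (w j)
      refine ⟨ModuleCat.ofHom (∑ j, ExtTensor.map k (v j) (w' j)), ModuleCat.hom_ext ?_⟩
      rw [hvw]
      refine ExtTensor.hom_ext fun x y => ?_
      change (∑ j, ExtTensor.map k (v j) (w' j)) (ExtTensor.tmul k x y.1) = _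
      simp only [LinearMap.sum_apply, ExtTensor.map_tmul, ← hw', LinearMap.comp_apply,
        Submodule.subtype_apply]

theorem subsingleton_ext_extTensor [Module.Finite k A] [Module.Finite k B]
    (hX : ∀ n : ℕ, 1 ≤ n → Subsingleton (Ext (ModuleCat.of A X) (ModuleCat.of A Y) n))
    (hM : ∀ n : ℕ, 1 ≤ n → Subsingleton (Ext (ModuleCat.of B M) (ModuleCat.of B N) n))
    (n : ℕ) (hn : 1 ≤ n) :
    Subsingleton (Ext (ModuleCat.of (A ⊗[k] B) (ExtTensor k X M))
      (ModuleCat.of (A ⊗[k] B) (ExtTensor k Y N)) n) := by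
  refine subsingleton_ext_extTensor_of_left k (fun r n hn => ?_) hX n hn
  refine subsingleton_ext_extTensor_of_right k (fun s n hn => ?_) hM n hn
  -- With both factors free, the first argument is a summand of a power of the regular module, hence
  -- has no higher `Ext`.
  have h : InAdd (A ⊗[k] B) (A ⊗[k] B) (ExtTensor k (Fin r → A) (Fin s → B)) :=
    ((InAdd.pi r).extTensor (InAdd.pi s)).trans (InAdd.self.of_equiv (regularTensorEquiv k A B).symm)
  refine h.subsingleton_ext_left _ n (subsingleton_of_forall_eq 0 fun e => ?_)
  obtain ⟨n, rfl⟩ := Nat.exists_eq_add_of_le' hn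
  have : Projective (ModuleCat.of (A ⊗[k] B) (A ⊗[k] B)) :=
    ModuleCat.projective_of_free (Module.Basis.singleton Unit _)
  exact Ext.eq_zero_of_projective e

end ForwardExt

/-! ### Injective dimension of external tensor products -/

section ForwardInjective

open CategoryTheory Abelian

variable (k : Type u) {A B X M : Type u} [Field k] [Ring A] [Ring B] [Algebra k A]
  [Algebra k B] [AddCommGroup X] [AddCommGroup M] [Module k X] [Module k M]
  [Module A X] [Module B M] [IsScalarTower k A X] [IsScalarTower k B M]

-- Baer's criterion combined with the adjunction `Hom_A(I, D(A)) ≅ Hom_k(I, k)`, `g ↦ (x ↦ g x 1)`: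
-- the functional attached to `g` extends to `A` because `k` is a field.
variable (A) in
theorem injective_dualRegular : Module.Injective A (DualRegular k A) := by
  refine Module.Baer.injective fun I g => ?_
  let φ : I.restrictScalars k →ₗ[k] k :=
    LinearMap.applyₗ (1 : A) ∘ₗ
      (show I.restrictScalars k →ₗ[k] (A →ₗ[k] k) from
        { toFun := fun x => g x
          map_add' := fun x y => g.map_add x y
          map_smul' := fun c x => (g.restrictScalars k).map_smul c x })
  obtain ⟨ψ, hψ⟩ := LinearMap.exists_extend φ
  refine ⟨LinearMap.toSpanSingleton A (DualRegular k A) ψ, fun x hx => ?_⟩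
  refine LinearMap.ext fun y => ?_
  have h1 : ψ (y * x) = φ ⟨y * x, I.mul_mem_left y hx⟩ :=
    LinearMap.congr_fun hψ (⟨y * x, I.mul_mem_left y hx⟩ : I.restrictScalars k)
  have h2 : g ⟨y * x, I.mul_mem_left y hx⟩ = y • g ⟨x, hx⟩ := g.map_smul y ⟨x, hx⟩
  have h3 : φ ⟨y * x, I.mul_mem_left y hx⟩ =
    (show A →ₗ[k] k from g ⟨y * x, I.mul_mem_left y hx⟩) 1 := rfl
  refine h1.trans (h3.trans ?_)
  rw [h2, DualRegular.smul_apply, one_mul]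

variable [Module.Finite k X] [Module.Finite k M]

variable (A X) in
/-- The embedding of a finite-dimensional module into a power of the dual of the regular module. -/
noncomputable def toDualRegularPi : X →ₗ[A] (Fin (Module.finrank k X) → DualRegular k A) :=
  LinearMap.pi fun j =>
    { toFun := fun x => show A →ₗ[k] k from
        { toFun := fun a => (Module.finBasis k X).coord j (a • x)
          map_add' := fun a b => by rw [add_smul, map_add]
          map_smul' := fun c a => by rw [smul_assoc, map_smul, RingHom.id_apply] }
      map_add' := fun x y => LinearMap.ext fun a => by
        change (Module.finBasis k X).coord j (a • (x + y)) =
          (Module.finBasis k X).coord j (a • x) + (Module.finBasis k X).coord j (a • y)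
        rw [smul_add, map_add]
      map_smul' := fun b x => LinearMap.ext fun a => by
        change (Module.finBasis k X).coord j (a • b • x) =
          (Module.finBasis k X).coord j ((a * b) • x)
        rw [mul_smul] }

theorem toDualRegularPi_apply (x : X) (j : Fin (Module.finrank k X)) (a : A) :
    (show A →ₗ[k] k from toDualRegularPi k A X x j) a = (Module.finBasis k X).coord j (a • x) :=
  rfl

variable (A X) in
theorem toDualRegularPi_injective : Function.Injective (toDualRegularPi k A X) := by
  intro x y h
  refine (Module.finBasis k X).ext_elem fun j => ?_
  have e := toDualRegularPi_apply k x j (1 : A)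
  rw [h, toDualRegularPi_apply, one_smul, one_smul] at e
  exact e.symm

theorem inAdd_dualRegular_of_injective (h : Module.Injective A X) :
    InAdd A (DualRegular k A) X := by
  obtain ⟨p, hp⟩ := h.out (toDualRegularPi k A X) (toDualRegularPi_injective k A X) LinearMap.id
  exact ⟨_, toDualRegularPi k A X, p, LinearMap.ext hp⟩

-- Induction along cosyzygies of `X` in powers of `D(A)`, tensored with `M`. An injective `X` is
-- itself a summand of such a power, which gives the base case.
omit [Module.Finite k M] in
theorem hasInjectiveDimensionLE_extTensor_of_left [Module.Finite k A] (s : ℕ)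
    (hD : HasInjectiveDimensionLE (ModuleCat.of (A ⊗[k] B) (ExtTensor k (DualRegular k A) M)) s)
    (r : ℕ) (hX : HasInjectiveDimensionLE (ModuleCat.of A X) r) :
    HasInjectiveDimensionLE (ModuleCat.of (A ⊗[k] B) (ExtTensor k X M)) (r + s) := by
  induction r generalizing X with
  | zero =>
    rw [zero_add]
    have : Injective (ModuleCat.of A X) := (injective_iff_hasInjectiveDimensionLT_one).2 hX
    have := Module.injective_module_of_injective_object A X
    exact ((inAdd_dualRegular_of_injective k this).extTensor InAdd.self).hasInjectiveDimensionLE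
      s hD
  | succ r ih =>
    let f := toDualRegularPi k A X
    have hex : Function.Exact f (LinearMap.range f).mkQ := f.exact_map_mkQ_range
    have hinj : Function.Injective f := toDualRegularPi_injective k A X
    have hsurj := (LinearMap.range f).mkQ_surjective
    have hS := exactPair_shortExact hex hinj hsurj
    have hS' := exactPair_shortExact (ExtTensor.map_id_right_exact (B := B) k M hex)
      (ExtTensor.map_id_right_injective k M hinj) (ExtTensor.map_id_right_surjective k M hsurj)
    have := Submodule.finite_quotient_of_isScalarTower k (LinearMap.range f)
    have h₂ : HasInjectiveDimensionLT
        (ModuleCat.of A (Fin (Module.finrank k X) → DualRegular k A)) 1 :=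
      (InAdd.pi _).hasInjectiveDimensionLE 0 ((injective_iff_hasInjectiveDimensionLT_one).1
        (@Module.injective_object_of_injective_module A (DualRegular k A) _ _ _
          (injective_dualRegular k A)))
    have h₂' : HasInjectiveDimensionLE (ModuleCat.of (A ⊗[k] B)
        (ExtTensor k (Fin (Module.finrank k X) → DualRegular k A) M)) s :=
      ((InAdd.pi _).extTensor InAdd.self).hasInjectiveDimensionLE s hD
    have h₃ := ih (hS.hasInjectiveDimensionLT_X₃ (r + 1)
      (hasInjectiveDimensionLE_mono h₂ (by omega)) hX)
    have := hS'.hasInjectiveDimensionLT_X₁ (r + s + 1) h₃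
      (hasInjectiveDimensionLE_mono h₂' (by omega))
    exact hasInjectiveDimensionLE_mono (n := r + s + 1) this (by omega)

omit [Module.Finite k X] in
theorem hasInjectiveDimensionLE_extTensor_of_right [Module.Finite k B] (s : ℕ)
    (hD : HasInjectiveDimensionLE (ModuleCat.of (A ⊗[k] B) (ExtTensor k X (DualRegular k B))) s)
    (r : ℕ) (hM : HasInjectiveDimensionLE (ModuleCat.of B M) r) :
    HasInjectiveDimensionLE (ModuleCat.of (A ⊗[k] B) (ExtTensor k X M)) (r + s) := by
  induction r generalizing M with
  | zero =>
    rw [zero_add]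
    have : Injective (ModuleCat.of B M) := (injective_iff_hasInjectiveDimensionLT_one).2 hM
    have := Module.injective_module_of_injective_object B M
    exact (InAdd.self.extTensor (inAdd_dualRegular_of_injective k this)).hasInjectiveDimensionLE
      s hD
  | succ r ih =>
    let f := toDualRegularPi k B M
    have hex : Function.Exact f (LinearMap.range f).mkQ := f.exact_map_mkQ_range
    have hinj : Function.Injective f := toDualRegularPi_injective k B M
    have hsurj := (LinearMap.range f).mkQ_surjective
    have hS := exactPair_shortExact hex hinj hsurj
    have hS' := exactPair_shortExact (ExtTensor.map_id_left_exact (A := A) k X hex)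
      (ExtTensor.map_id_left_injective k X hinj) (ExtTensor.map_id_left_surjective k X hsurj)
    have := Submodule.finite_quotient_of_isScalarTower k (LinearMap.range f)
    have h₂ : HasInjectiveDimensionLT
        (ModuleCat.of B (Fin (Module.finrank k M) → DualRegular k B)) 1 :=
      (InAdd.pi _).hasInjectiveDimensionLE 0 ((injective_iff_hasInjectiveDimensionLT_one).1
        (@Module.injective_object_of_injective_module B (DualRegular k B) _ _ _
          (injective_dualRegular k B)))
    have h₂' : HasInjectiveDimensionLE (ModuleCat.of (A ⊗[k] B)
        (ExtTensor k X (Fin (Module.finrank k M) → DualRegular k B))) s :=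
      (InAdd.self.extTensor (InAdd.pi _)).hasInjectiveDimensionLE s hD
    have h₃ := ih (hS.hasInjectiveDimensionLT_X₃ (r + 1)
      (hasInjectiveDimensionLE_mono h₂ (by omega)) hM)
    have := hS'.hasInjectiveDimensionLT_X₁ (r + s + 1) h₃
      (hasInjectiveDimensionLE_mono h₂' (by omega))
    exact hasInjectiveDimensionLE_mono (n := r + s + 1) this (by omega)

theorem hasInjectiveDimensionLE_extTensor [Module.Finite k A] [Module.Finite k B] (r s : ℕ)
    (hX : HasInjectiveDimensionLE (ModuleCat.of A X) r)
    (hM : HasInjectiveDimensionLE (ModuleCat.of B M) s) :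
    HasInjectiveDimensionLE (ModuleCat.of (A ⊗[k] B) (ExtTensor k X M)) (r + s) := by
  refine hasInjectiveDimensionLE_extTensor_of_left k _ ?_ r hX
  refine hasInjectiveDimensionLE_extTensor_of_right k 0 ?_ s hM
  refine (InAdd.self.of_equiv (dualRegularTensorEquiv k A B).symm).hasInjectiveDimensionLE 0 ?_
  exact (injective_iff_hasInjectiveDimensionLT_one).1
    (@Module.injective_object_of_injective_module _ (DualRegular k (A ⊗[k] B)) _ _ _
      (injective_dualRegular k (A ⊗[k] B)))

end ForwardInjective

/-! ### Reflecting the vanishing of `Ext` along exact functors -/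

section ExtReflect

open CategoryTheory Abelian Limits

variable {C D : Type*} [Category* C] [Category* D] [Abelian C] [Abelian D] [HasExt C] [HasExt D]
  [EnoughProjectives C]
  (F : C ⥤ D) [F.Additive] [PreservesFiniteLimits F] [PreservesFiniteColimits F]
  (G : D ⥤ C) [G.Additive] [PreservesFiniteLimits G] [PreservesFiniteColimits G]
  (η : ∀ X : C, X ⟶ G.obj (F.obj X))

variable (hη : ∀ {X Y : C} (f : X ⟶ Y), f ≫ η Y = η X ≫ G.map (F.map f))

-- Naturality of `η` on morphisms propagates to all degrees: a class of degree `n + 1` is an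
-- extension class composed with one of degree `n`, and `η` is a morphism from a short exact
-- sequence to its image under the two exact functors.
include hη in
theorem mk₀_comp_mapExactFunctor_mapExactFunctor {X Y : C} {n : ℕ} (e : Ext X Y n) :
    (Ext.mk₀ (η X)).comp ((e.mapExactFunctor F).mapExactFunctor G) (zero_add n) =
      e.comp (Ext.mk₀ (η Y)) (add_zero n) := by
  induction n generalizing X with
  | zero =>
    obtain ⟨f, rfl⟩ := Ext.mk₀_bijective _ _ |>.surjective e
    rw [Ext.mapExactFunctor_mk₀, Ext.mapExactFunctor_mk₀, Ext.mk₀_comp_mk₀, Ext.mk₀_comp_mk₀, hη]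
  | succ n ih =>
    let P : ProjectivePresentation X := Classical.arbitrary _
    let S := ShortComplex.mk _ _ (kernel.condition P.f)
    have hS : S.ShortExact := { exact := ShortComplex.exact_kernel P.f }
    obtain ⟨x, rfl⟩ := Ext.contravariant_sequence_exact₃ hS Y e
      (Ext.eq_zero_of_projective (P := P.p) _) (add_comm 1 n)
    have hS' := (hS.map_of_exact F).map_of_exact G
    let φ : S ⟶ (S.map F).map G :=
      { τ₁ := η S.X₁
        τ₂ := η S.X₂
        τ₃ := η S.X₃
        comm₁₂ := (hη S.f).symm
        comm₂₃ := (hη S.g).symm }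
    have hδ : (hS.extClass.mapExactFunctor F).mapExactFunctor G = hS'.extClass :=
      (congrArg (Ext.mapExactFunctor G) (Ext.mapExactFunctor_extClass F hS)).trans
        (Ext.mapExactFunctor_extClass G (hS.map_of_exact F))
    have nat : (Ext.mk₀ (η S.X₃)).comp ((hS.extClass.mapExactFunctor F).mapExactFunctor G)
        (zero_add 1) = hS.extClass.comp (Ext.mk₀ (η S.X₁)) (add_zero 1) :=
      (congrArg (fun y => Ext.comp (Ext.mk₀ (η S.X₃)) y (zero_add 1)) hδ).trans
        (ShortComplex.ShortExact.extClass_naturality hS hS' φ).symm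
    change (Ext.mk₀ (η S.X₃)).comp _ _ = _
    rw [Ext.mapExactFunctor_comp, Ext.mapExactFunctor_comp, Ext.comp_assoc_of_third_deg_zero, ← ih,
      ← Ext.comp_assoc _ _ _ (zero_add 1) (add_comm 1 n) (by omega), nat,
      Ext.comp_assoc _ _ _ (add_zero 1) (zero_add n) (by omega)]

-- If `F e = 0`, then `e` followed by `η Y` vanishes, and composing with `r` recovers `e`. A
-- retraction at `Y` alone suffices, with no naturality required of it.
include hη in
theorem subsingleton_ext_of_split_unit {X Y : C} {n : ℕ} (r : G.obj (F.obj Y) ⟶ Y)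
    (hr : η Y ≫ r = 𝟙 Y) (h : Subsingleton (Ext (F.obj X) (F.obj Y) n)) :
    Subsingleton (Ext X Y n) := by
  refine subsingleton_of_forall_eq 0 fun e => ?_
  have e1 := mk₀_comp_mapExactFunctor_mapExactFunctor F G η hη e
  rw [Subsingleton.elim (e.mapExactFunctor F) 0, Ext.mapExactFunctor_zero, Ext.comp_zero] at e1
  rw [← Ext.comp_mk₀_id e, ← hr, ← Ext.mk₀_comp_mk₀, ← Ext.comp_assoc_of_second_deg_zero, ← e1,
    Ext.zero_comp]

end ExtReflect

/-! ### The functors `- ⊗ L` and `T ⊗ -`, and descent of the homological conditions -/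

section ExactFunctors

open CategoryTheory Limits

theorem preservesFiniteLimits_and_colimits_of_exact {R S : Type u} [Ring R] [Ring S]
    (F : ModuleCat.{u} R ⥤ ModuleCat.{u} S) [F.Additive]
    (h : ∀ {X Y Z : ModuleCat.{u} R} (f : X ⟶ Y) (g : Y ⟶ Z),
      Function.Exact f.hom g.hom → Function.Exact (F.map f).hom (F.map g).hom) :
    PreservesFiniteLimits F ∧ PreservesFiniteColimits F := by
  refine ((CategoryTheory.Functor.exact_tfae F).out 1 3).mp fun T hT => ?_
  rw [ShortComplex.ShortExact.moduleCat_exact_iff_function_exact] at hT ⊢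
  exact h T.f T.g hT

instance {R S : Type u} [Ring R] [Ring S] (f : R →+* S) :
    PreservesFiniteLimits (ModuleCat.restrictScalars.{u} f) :=
  (preservesFiniteLimits_and_colimits_of_exact (ModuleCat.restrictScalars.{u} f)
    fun _ _ h => h).1

instance {R S : Type u} [Ring R] [Ring S] (f : R →+* S) :
    PreservesFiniteColimits (ModuleCat.restrictScalars.{u} f) :=
  (preservesFiniteLimits_and_colimits_of_exact (ModuleCat.restrictScalars.{u} f)
    fun _ _ h => h).2

/-- Objects of `ModuleCat A` carry the `k`-structure induced from `A`. Substituting this equality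
lets results about such objects apply to a module with a prescribed `k`-structure. -/
theorem Module.eq_restrictScalars (k A : Type*) {T : Type*} [Field k] [Ring A] [Algebra k A]
    [AddCommGroup T] [inst : Module k T] [Module A T] [IsScalarTower k A T] :
    inst = Module.restrictScalars k A T :=
  Module.ext' _ _ fun c t => (algebraMap_smul A c t).symm

attribute [local instance] ModuleCat.moduleOfAlgebraModule
attribute [local instance] ModuleCat.isScalarTower_of_algebra_moduleCat

variable (k : Type u) (A B T L : Type u) [Field k] [Ring A] [Ring B] [Algebra k A] [Algebra k B]
  [AddCommGroup T] [AddCommGroup L] [Module k T] [Module k L]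
  [Module A T] [Module B L] [IsScalarTower k A T] [IsScalarTower k B L]

/-- The functor `- ⊗ L` from `A`-modules to `A ⊗ B`-modules. -/
noncomputable def tensorRightFunctor : ModuleCat.{u} A ⥤ ModuleCat.{u} (A ⊗[k] B) where
  obj X := ModuleCat.of (A ⊗[k] B) (ExtTensor k X L)
  map f := ModuleCat.ofHom (ExtTensor.map k f.hom (LinearMap.id : L →ₗ[B] L))
  map_id _ := ModuleCat.hom_ext (ExtTensor.map_id_id k)
  map_comp f g := ModuleCat.hom_ext (ExtTensor.map_comp_map k f.hom LinearMap.id g.hom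
    (LinearMap.id : L →ₗ[B] L)).symm

instance : (tensorRightFunctor k A B L).Additive where
  map_add := ModuleCat.hom_ext (ExtTensor.map_add_left k _ _ _)

instance : PreservesFiniteLimits (tensorRightFunctor k A B L) :=
  (preservesFiniteLimits_and_colimits_of_exact _ fun _ _ h =>
    ExtTensor.map_id_right_exact k L h).1

instance : PreservesFiniteColimits (tensorRightFunctor k A B L) :=
  (preservesFiniteLimits_and_colimits_of_exact _ fun _ _ h =>
    ExtTensor.map_id_right_exact k L h).2

/-- The functor `T ⊗ -` from `B`-modules to `A ⊗ B`-modules. -/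
noncomputable def tensorLeftFunctor : ModuleCat.{u} B ⥤ ModuleCat.{u} (A ⊗[k] B) where
  obj X := ModuleCat.of (A ⊗[k] B) (ExtTensor k T X)
  map f := ModuleCat.ofHom (ExtTensor.map k (LinearMap.id : T →ₗ[A] T) f.hom)
  map_id _ := ModuleCat.hom_ext (ExtTensor.map_id_id k)
  map_comp f g := ModuleCat.hom_ext (ExtTensor.map_comp_map k (LinearMap.id : T →ₗ[A] T) f.hom
    LinearMap.id g.hom).symm

instance : (tensorLeftFunctor k A B T).Additive where
  map_add := ModuleCat.hom_ext (ExtTensor.map_add_right k _ _ _)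

instance : PreservesFiniteLimits (tensorLeftFunctor k A B T) :=
  (preservesFiniteLimits_and_colimits_of_exact _ fun _ _ h =>
    ExtTensor.map_id_left_exact k T h).1

instance : PreservesFiniteColimits (tensorLeftFunctor k A B T) :=
  (preservesFiniteLimits_and_colimits_of_exact _ fun _ _ h =>
    ExtTensor.map_id_left_exact k T h).2

/-- Restriction of `A ⊗ B`-modules to `A`-modules. -/
noncomputable abbrev restrictLeft : ModuleCat.{u} (A ⊗[k] B) ⥤ ModuleCat.{u} A :=
  ModuleCat.restrictScalars (Algebra.TensorProduct.includeLeft : A →ₐ[k] A ⊗[k] B).toRingHom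

/-- Restriction of `A ⊗ B`-modules to `B`-modules. -/
noncomputable abbrev restrictRight : ModuleCat.{u} (A ⊗[k] B) ⥤ ModuleCat.{u} B :=
  ModuleCat.restrictScalars (Algebra.TensorProduct.includeRight : B →ₐ[k] A ⊗[k] B).toRingHom

/-- A fixed `l ≠ 0` makes `x ↦ x ⊗ l` natural in `X`, and a functional with value `1` at `l` splits
it. -/
theorem subsingleton_ext_of_tensorRight [Nontrivial L] (X Y : ModuleCat.{u} A) (n : ℕ)
    (h : Subsingleton (Abelian.Ext ((tensorRightFunctor k A B L).obj X)
      ((tensorRightFunctor k A B L).obj Y) n)) :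
    Subsingleton (Abelian.Ext X Y n) := by
  obtain ⟨l, hl⟩ := exists_ne (0 : L)
  obtain ⟨φ, hφ⟩ := Module.Projective.exists_dual_eq_one k hl
  let η (X : ModuleCat.{u} A) : X ⟶ (restrictLeft k A B).obj ((tensorRightFunctor k A B L).obj X) :=
    ModuleCat.ofHom (Y := (restrictLeft k A B).obj ((tensorRightFunctor k A B L).obj X))
      { toFun := fun x => ExtTensor.tmul k x l
        map_add' := fun x y => ExtTensor.add_tmul x y l
        map_smul' := fun a x => by
          change _ = (a ⊗ₜ[k] (1 : B)) • ExtTensor.tmul k x l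
          rw [ExtTensor.smul_tmul_tmul, one_smul] }
  let r : (restrictLeft k A B).obj ((tensorRightFunctor k A B L).obj Y) ⟶ Y :=
    ModuleCat.ofHom (X := (restrictLeft k A B).obj ((tensorRightFunctor k A B L).obj Y))
      { toFun := fun v => ExtTensor.contract k Y φ v
        map_add' := fun v w => map_add (ExtTensor.contract k Y φ) v w
        map_smul' := fun a v => ExtTensor.contract_smul (B := B) k φ a v }
  refine subsingleton_ext_of_split_unit (tensorRightFunctor k A B L) (restrictLeft k A B) η
    (fun f => rfl) r ?_ h
  refine ModuleCat.hom_ext (LinearMap.ext fun y => ?_)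
  refine (ExtTensor.contract_tmul k φ y l).trans ?_
  rw [hφ, one_smul]
  rfl

theorem subsingleton_ext_of_tensorLeft [Nontrivial T] (X Y : ModuleCat.{u} B) (n : ℕ)
    (h : Subsingleton (Abelian.Ext ((tensorLeftFunctor k A B T).obj X)
      ((tensorLeftFunctor k A B T).obj Y) n)) :
    Subsingleton (Abelian.Ext X Y n) := by
  obtain ⟨t, ht⟩ := exists_ne (0 : T)
  obtain ⟨φ, hφ⟩ := Module.Projective.exists_dual_eq_one k ht
  let η (X : ModuleCat.{u} B) : X ⟶ (restrictRight k A B).obj ((tensorLeftFunctor k A B T).obj X) :=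
    ModuleCat.ofHom (Y := (restrictRight k A B).obj ((tensorLeftFunctor k A B T).obj X))
      { toFun := fun x => ExtTensor.tmul k t x
        map_add' := fun x y => ExtTensor.tmul_add t x y
        map_smul' := fun b x => by
          change _ = ((1 : A) ⊗ₜ[k] b) • ExtTensor.tmul k t x
          rw [ExtTensor.smul_tmul_tmul, one_smul] }
  let r : (restrictRight k A B).obj ((tensorLeftFunctor k A B T).obj Y) ⟶ Y :=
    ModuleCat.ofHom (X := (restrictRight k A B).obj ((tensorLeftFunctor k A B T).obj Y))
      { toFun := fun v => ExtTensor.contractLeft k Y φ v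
        map_add' := fun v w => map_add (ExtTensor.contractLeft k Y φ) v w
        map_smul' := fun b v => ExtTensor.contractLeft_smul (A := A) k φ b v }
  refine subsingleton_ext_of_split_unit (tensorLeftFunctor k A B T) (restrictRight k A B) η
    (fun f => rfl) r ?_ h
  refine ModuleCat.hom_ext (LinearMap.ext fun y => ?_)
  refine (ExtTensor.contractLeft_tmul k φ t y).trans ?_
  rw [hφ, one_smul]
  rfl

variable {A B T L}

theorem subsingleton_ext_left_of_extTensor [Nontrivial L] (n : ℕ)
    (h : Subsingleton (Abelian.Ext (ModuleCat.of (A ⊗[k] B) (ExtTensor k T L))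
      (ModuleCat.of (A ⊗[k] B) (ExtTensor k T L)) n)) :
    Subsingleton (Abelian.Ext (ModuleCat.of A T) (ModuleCat.of A T) n) := by
  have hk := Module.eq_restrictScalars k A (T := T)
  subst hk
  exact subsingleton_ext_of_tensorRight k A B L _ _ n h

theorem subsingleton_ext_right_of_extTensor [Nontrivial T] (n : ℕ)
    (h : Subsingleton (Abelian.Ext (ModuleCat.of (A ⊗[k] B) (ExtTensor k T L))
      (ModuleCat.of (A ⊗[k] B) (ExtTensor k T L)) n)) :
    Subsingleton (Abelian.Ext (ModuleCat.of B L) (ModuleCat.of B L) n) := by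
  have hk := Module.eq_restrictScalars k B (T := L)
  subst hk
  exact subsingleton_ext_of_tensorLeft k A B T _ _ n h

/-- The bound is tested on every `A`-module `Y`, by comparing with `Ext^i(Y ⊗ L, T ⊗ L)` for `i >
r`; no finiteness of `Y` is needed. -/
theorem hasInjectiveDimensionLE_left_of_extTensor [Nontrivial L] (r : ℕ)
    (h : HasInjectiveDimensionLE (ModuleCat.of (A ⊗[k] B) (ExtTensor k T L)) r) :
    HasInjectiveDimensionLE (ModuleCat.of A T) r := by
  have hk := Module.eq_restrictScalars k A (T := T)
  subst hk
  refine (hasInjectiveDimensionLT_iff _ _).2 fun i hi Y e => ?_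
  have := subsingleton_ext_of_tensorRight k A B L Y (ModuleCat.of A T) i
    (HasInjectiveDimensionLT.subsingleton (hX := h) _ (r + 1) i hi _)
  exact Subsingleton.elim _ _

theorem hasInjectiveDimensionLE_right_of_extTensor [Nontrivial T] (r : ℕ)
    (h : HasInjectiveDimensionLE (ModuleCat.of (A ⊗[k] B) (ExtTensor k T L)) r) :
    HasInjectiveDimensionLE (ModuleCat.of B L) r := by
  have hk := Module.eq_restrictScalars k B (T := L)
  subst hk
  refine (hasInjectiveDimensionLT_iff _ _).2 fun i hi Y e => ?_
  have := subsingleton_ext_of_tensorLeft k A B T Y (ModuleCat.of B L) i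
    (HasInjectiveDimensionLT.subsingleton (hX := h) _ (r + 1) i hi _)
  exact Subsingleton.elim _ _

end ExactFunctors

/-! ### Closure properties of modules with finite `add(T)`-resolutions -/

section AddResolution

open CategoryTheory Abelian

/-- `Y` has an `add(T)`-resolution of length at most `m`, described recursively through the
kernel of the first map. -/
def AddResolution (A T : Type u) [Ring A] [AddCommGroup T] [Module A T] :
    ℕ → ∀ (Y : Type u) [AddCommGroup Y] [Module A Y], Prop
  | 0, Y, _, _ => InAdd A T Y
  | m + 1, Y, _, _ => ∃ (X : Type u) (_ : AddCommGroup X) (_ : Module A X) (g : X →ₗ[A] Y),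
      InAdd A T X ∧ Function.Surjective g ∧ AddResolution A T m (LinearMap.ker g)

variable {A T X Y Z : Type u} [Ring A] [AddCommGroup T] [Module A T] [AddCommGroup X] [Module A X]
  [AddCommGroup Y] [Module A Y] [AddCommGroup Z] [Module A Z]

theorem AddResolution.of_equiv {m : ℕ} (h : AddResolution A T m X) (e : X ≃ₗ[A] Y) :
    AddResolution A T m Y := by
  cases m with
  | zero => exact InAdd.of_equiv h e
  | succ m =>
    obtain ⟨W, _, _, g, hW, hg, hK⟩ := h
    refine ⟨W, _, _, e.toLinearMap ∘ₗ g, hW, e.surjective.comp hg, ?_⟩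
    rwa [LinearEquiv.ker_comp]

theorem AddResolution.of_exact {m : ℕ} {f : X →ₗ[A] Y} {g : Y →ₗ[A] Z}
    (h : Function.Exact f g) (hf : Function.Injective f) (hg : Function.Surjective g)
    (hX : AddResolution A T m X) (hY : InAdd A T Y) : AddResolution A T (m + 1) Z :=
  ⟨Y, _, _, g, hY, hg, hX.of_equiv
    ((LinearEquiv.ofInjective f hf).trans (LinearEquiv.ofEq _ _ h.linearMap_ker_eq.symm))⟩

theorem AddResolution.succ {m : ℕ} (h : AddResolution A T m X) : AddResolution A T (m + 1) X := by
  induction m generalizing X with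
  | zero =>
    refine ⟨X, _, _, LinearMap.id, h, Function.surjective_id, ?_⟩
    have : Subsingleton (LinearMap.ker (LinearMap.id : X →ₗ[A] X)) := by
      rw [LinearMap.ker_id]
      infer_instance
    exact InAdd.of_subsingleton
  | succ m ih =>
    obtain ⟨W, _, _, g, hW, hg, hK⟩ := h
    exact ⟨W, _, _, g, hW, hg, ih hK⟩

theorem AddResolution.mono {m n : ℕ} (h : AddResolution A T m X) (hmn : m ≤ n) :
    AddResolution A T n X := by
  induction n, hmn using Nat.le_induction with
  | base => exact h
  | succ n _ ih => exact ih.succ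

theorem AddResolution.subsingleton_ext
    (hT : ∀ n : ℕ, 1 ≤ n → Subsingleton (Ext (ModuleCat.of A T) (ModuleCat.of A T) n))
    {m : ℕ} (h : AddResolution A T m X) (n : ℕ) (hn : 1 ≤ n) :
    Subsingleton (Ext (ModuleCat.of A T) (ModuleCat.of A X) n) := by
  induction m generalizing X n with
  | zero => exact InAdd.subsingleton_ext_right h _ n (hT n hn)
  | succ m ih =>
    obtain ⟨W, _, _, g, hW, hg, hK⟩ := h
    exact subsingleton_ext_X₃ (exactPair_shortExact (LinearMap.exact_subtype_ker_map g)
      (LinearMap.ker g).subtype_injective hg) _ n (hW.subsingleton_ext_right _ n (hT n hn))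
      (ih hK (n + 1) (by omega))

/-- A horseshoe argument: `Ext¹(V, X) = 0` lifts the cover `q : V → Z` to `Y`, so `U × V` covers
`Y`, with kernel an extension of `ker q` by `ker p`. In length zero the sequence splits. -/
theorem AddResolution.extension
    (hT : ∀ n : ℕ, 1 ≤ n → Subsingleton (Ext (ModuleCat.of A T) (ModuleCat.of A T) n))
    {m : ℕ} (hX : AddResolution A T m X) (hZ : AddResolution A T m Z)
    {f : X →ₗ[A] Y} {g : Y →ₗ[A] Z} (h : Function.Exact f g) (hf : Function.Injective f)
    (hg : Function.Surjective g) : AddResolution A T m Y := by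
  induction m generalizing X Y Z with
  | zero =>
    have hZ' : InAdd A T Z := hZ
    obtain ⟨s, hs⟩ := exists_lift_of_subsingleton_ext_one_ker h hf hg
      (hZ'.subsingleton_ext_left _ 1 (hX.subsingleton_ext hT 1 le_rfl)) LinearMap.id
    have hs' (z : Z) : g (s z) = z := LinearMap.congr_fun hs z
    have hXZ : InAdd A T (X × Z) := InAdd.prod hX hZ
    refine hXZ.of_equiv (LinearEquiv.ofBijective (f.coprod s) ⟨?_, fun y => ?_⟩)
    · rw [injective_iff_map_eq_zero]
      rintro ⟨x, z⟩ hxz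
      rw [LinearMap.coprod_apply] at hxz
      have hz : z = 0 := by
        have := congrArg g hxz
        rwa [map_add, h.apply_apply_eq_zero, zero_add, hs', map_zero] at this
      subst hz
      rw [map_zero, add_zero] at hxz
      exact Prod.ext (hf (hxz.trans (map_zero f).symm)) rfl
    · obtain ⟨x, hx⟩ := (h (y - s (g y))).1 (by rw [map_sub, hs', sub_self])
      exact ⟨(x, g y), by rw [LinearMap.coprod_apply, hx, sub_add_cancel]⟩
  | succ m ih =>
    have hExt := hX.subsingleton_ext hT 1 le_rfl
    obtain ⟨U, _, _, p, hU, hp, hpK⟩ := hX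
    obtain ⟨V, _, _, q, hV, hq, hqK⟩ := hZ
    obtain ⟨s, hs⟩ := exists_lift_of_subsingleton_ext_one_ker h hf hg
      (hV.subsingleton_ext_left _ 1 hExt) q
    have hs' (v : V) : g (s v) = q v := LinearMap.congr_fun hs v
    let G : U × V →ₗ[A] Y := (f ∘ₗ p).coprod s
    have hG (c : U × V) : G c = f (p c.1) + s c.2 := rfl
    let i : LinearMap.ker p →ₗ[A] LinearMap.ker G :=
      (LinearMap.inl A U V ∘ₗ (LinearMap.ker p).subtype).codRestrict _ fun a => by
        rw [LinearMap.mem_ker, hG]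
        simp
    let r : LinearMap.ker G →ₗ[A] LinearMap.ker q :=
      (LinearMap.snd A U V ∘ₗ (LinearMap.ker G).subtype).codRestrict _ fun c => by
        have := congrArg g (LinearMap.mem_ker.1 c.2)
        rw [hG, map_add, h.apply_apply_eq_zero, zero_add, hs', map_zero] at this
        exact this
    refine ⟨U × V, _, _, G, hU.prod hV, fun y => ?_, ih hpK hqK (f := i) (g := r) ?_ ?_ ?_⟩
    · obtain ⟨v, hv⟩ := hq (g y)
      obtain ⟨x, hx⟩ := (h (y - s v)).1 (by rw [map_sub, hs', hv, sub_self])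
      obtain ⟨a, rfl⟩ := hp x
      exact ⟨(a, v), by rw [hG, hx, sub_add_cancel]⟩
    · rintro ⟨⟨a, b⟩, hab⟩
      constructor
      · intro hb
        have hb : b = 0 := congrArg Subtype.val hb
        subst hb
        have ha : p a = 0 := by
          rw [LinearMap.mem_ker, hG, map_zero, add_zero] at hab
          exact hf (hab.trans (map_zero f).symm)
        exact ⟨⟨a, ha⟩, rfl⟩
      · rintro ⟨a', ha'⟩
        have : b = 0 := (congrArg (fun c => c.1.2) ha').symm
        exact Subtype.ext this
    · intro a b hab
      exact Subtype.ext (congrArg (fun c => c.1.1) hab)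
    · rintro ⟨b, hb⟩
      obtain ⟨x, hx⟩ := (h (s b)).1 (by rw [hs', LinearMap.mem_ker.1 hb])
      obtain ⟨a, rfl⟩ := hp x
      exact ⟨⟨(-a, b), by rw [LinearMap.mem_ker, hG]; simp [hx]⟩, rfl⟩

/-- A cover `p : U → Y` composes to a cover of `Z`, whose kernel is an extension of `X` by `ker p`.
-/
theorem AddResolution.cokernel
    (hT : ∀ n : ℕ, 1 ≤ n → Subsingleton (Ext (ModuleCat.of A T) (ModuleCat.of A T) n))
    {m : ℕ} (hX : AddResolution A T m X) (hY : AddResolution A T m Y)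
    {f : X →ₗ[A] Y} {g : Y →ₗ[A] Z} (h : Function.Exact f g) (hf : Function.Injective f)
    (hg : Function.Surjective g) : AddResolution A T (m + 1) Z := by
  -- Padding by one makes `ker p` have length at most `m`, the same bound as `X`, as the extension
  -- lemma requires.
  obtain ⟨U, _, _, p, hU, hp, hpK⟩ := hY.succ
  let e := LinearEquiv.ofInjective f hf
  let i : LinearMap.ker p →ₗ[A] LinearMap.ker (g ∘ₗ p) :=
    (LinearMap.ker p).subtype.codRestrict _ fun a => by simp
  let r : LinearMap.ker (g ∘ₗ p) →ₗ[A] X := e.symm.toLinearMap ∘ₗ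
    (p ∘ₗ (LinearMap.ker (g ∘ₗ p)).subtype).codRestrict (LinearMap.range f)
      fun c => (h _).1 (LinearMap.mem_ker.1 c.2)
  have hr (c : LinearMap.ker (g ∘ₗ p)) : f (r c) = p c.1 :=
    congrArg Subtype.val (e.apply_symm_apply _)
  refine ⟨U, _, _, g ∘ₗ p, hU, hg.comp hp,
    hpK.extension hT hX (f := i) (g := r) (fun c => ?_) (fun a b hab => ?_) fun x => ?_⟩
  · constructor
    · intro hc
      have := hr c
      rw [hc, map_zero] at this
      exact ⟨⟨c.1, this.symm⟩, rfl⟩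
    · rintro ⟨a, rfl⟩
      refine hf ?_
      rw [hr, map_zero]
      exact a.2
  · exact Subtype.ext (congrArg (fun c => c.1) hab)
  · obtain ⟨a, ha⟩ := hp (f x)
    refine ⟨⟨a, ?_⟩, hf ?_⟩
    · rw [LinearMap.mem_ker, LinearMap.comp_apply, ha, h.apply_apply_eq_zero]
    · rw [hr, ha]

/-- A right `add(T)`-approximation of `Y`, assembled from a basis of the finite-dimensional space
`Hom_A(T, Y)`: the coordinates of a map `T → Y` give its factorization. -/
theorem exists_add_approximation (k : Type*) [Field k] [Algebra k A] [Module k T] [Module k Y]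
    [IsScalarTower k A T] [IsScalarTower k A Y] [Module.Finite k T] [Module.Finite k Y] :
    ∃ (n : ℕ) (t : (Fin n → T) →ₗ[A] Y),
      ∀ (X : Type u) [AddCommGroup X] [Module A X], InAdd A T X → ∀ u : X →ₗ[A] Y,
        ∃ v : X →ₗ[A] (Fin n → T), t ∘ₗ v = u := by
  have hfin : Module.Finite k (T →ₗ[A] Y) := ExtTensor.finite_hom k
  let b := Module.finBasis k (T →ₗ[A] Y)
  let t : (Fin (Module.finrank k (T →ₗ[A] Y)) → T) →ₗ[A] Y := ∑ j, b j ∘ₗ LinearMap.proj j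
  refine ⟨_, t, fun X _ _ hX u => ?_⟩
  have key (w : T →ₗ[A] Y) : ∃ v : T →ₗ[A] (Fin (Module.finrank k (T →ₗ[A] Y)) → T),
      t ∘ₗ v = w := by
    refine ⟨LinearMap.pi fun j => b.repr w j • LinearMap.id, ?_⟩
    conv_rhs => rw [← b.sum_repr w]
    ext x
    simp only [t, LinearMap.comp_apply, LinearMap.sum_apply, LinearMap.proj_apply,
      LinearMap.pi_apply, LinearMap.smul_apply, LinearMap.id_apply]
    exact Finset.sum_congr rfl fun j _ => map_smul ((b j).restrictScalars k) _ _
  obtain ⟨n, i, p, h⟩ := hX.exists_sum_eq_id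
  choose v hv using fun j => key (u ∘ₗ p j)
  refine ⟨∑ j, v j ∘ₗ i j, ?_⟩
  refine LinearMap.ext fun x => ?_
  have hx := LinearMap.congr_fun h x
  have hv' (j : Fin n) (y : T) : t (v j y) = u (p j y) := LinearMap.congr_fun (hv j) y
  simp only [LinearMap.sum_apply, LinearMap.comp_apply, LinearMap.id_apply] at hx
  simp only [LinearMap.sum_apply, LinearMap.comp_apply, map_sum, hv', ← map_sum u, hx]

/-- The resolution of `X` need not split compatibly with `Y`, so `Y` is covered by its
`add(T)`-approximation `t` instead. The kernel of `t` is then a retract of `ker g × T^n`, which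
allows induction on the length. -/
theorem AddResolution.of_retract (k : Type*) [Field k] [Algebra k A] [Module k T] [Module k Y]
    [IsScalarTower k A T] [IsScalarTower k A Y] [Module.Finite k T] [Module.Finite k Y]
    (hT : ∀ n : ℕ, 1 ≤ n → Subsingleton (Ext (ModuleCat.of A T) (ModuleCat.of A T) n))
    {m : ℕ} (hX : AddResolution A T m X) (i : Y →ₗ[A] X) (p : X →ₗ[A] Y)
    (hip : p ∘ₗ i = LinearMap.id) : AddResolution A T m Y := by
  induction m generalizing X Y with
  | zero => exact InAdd.of_retract hX i p hip
  | succ m ih =>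
    obtain ⟨U, _, _, g, hU, hg, hK⟩ := hX
    obtain ⟨n, t, ht⟩ := exists_add_approximation (A := A) (T := T) (Y := Y) k
    obtain ⟨β, hβ⟩ := ht U hU (p ∘ₗ g)
    have hpi : InAdd A T (Fin n → T) := InAdd.pi n
    obtain ⟨α, hα⟩ := exists_lift_of_subsingleton_ext_one_ker
      (LinearMap.exact_subtype_ker_map g) (LinearMap.ker g).subtype_injective hg
      (hpi.subsingleton_ext_left _ 1 (hK.subsingleton_ext hT 1 le_rfl)) (i ∘ₗ t)
    have hα' (v : Fin n → T) : g (α v) = i (t v) := LinearMap.congr_fun hα v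
    have hβ' (x : U) : t (β x) = p (g x) := LinearMap.congr_fun hβ x
    have hip' (y : Y) : p (i y) = y := LinearMap.congr_fun hip y
    have ht' : Function.Surjective t := fun y => by
      obtain ⟨x, hx⟩ := hg (i y)
      exact ⟨β x, by rw [hβ', hx, hip']⟩
    refine ⟨_, _, _, t, hpi, ht', ?_⟩
    have hKn : AddResolution A T m (LinearMap.ker g × (Fin n → T)) :=
      hK.extension hT (AddResolution.mono (m := 0) hpi (Nat.zero_le m))
        (f := LinearMap.inl A _ _) (g := LinearMap.snd A _ _) Function.Exact.inl_snd
        LinearMap.inl_injective LinearMap.snd_surjective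
    have := Submodule.finite_of_isScalarTower k (LinearMap.ker t)
    -- The section is `c ↦ (α c, c)` and the retraction is `(x, v) ↦ β x + v - β (α v)`. The latter
    -- lands in `ker t` because `t β α = p g α = p i t = t`.
    refine ih hKn
      (((α ∘ₗ (LinearMap.ker t).subtype).codRestrict (LinearMap.ker g) fun c => ?_).prod
        (LinearMap.ker t).subtype)
      ((β ∘ₗ (LinearMap.ker g).subtype).coprod (LinearMap.id - β ∘ₗ α) |>.codRestrict
        (LinearMap.ker t) fun c => ?_) ?_
    · rw [LinearMap.mem_ker]
      simp [hα']
    · rw [LinearMap.mem_ker]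
      simp [hα', hβ', hip']
    · ext c
      simp

end AddResolution

/-! ### Recursive and sequential forms of a resolution -/

section FiniteAddResolution

variable {A T : Type u} [Ring A] [AddCommGroup T] [Module A T]

/-- The shifted sequence resolves `ker ε`, with `d 0` as its augmentation; for `m = 0` the vanishing
of `X 1` makes `ε` an isomorphism. -/
theorem addResolution_of_sequence (m : ℕ) (X : ℕ → ModuleCat.{u} A)
    (d : ∀ j, X (j + 1) →ₗ[A] X j) (Y : Type u) [AddCommGroup Y] [Module A Y] (ε : X 0 →ₗ[A] Y)
    (hX : ∀ j, InAdd A T (X j)) (hm : ∀ j, m < j → Subsingleton (X j))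
    (hε : Function.Surjective ε) (hd0 : Function.Exact (d 0) ε)
    (hd : ∀ j, Function.Exact (d (j + 1)) (d j)) : AddResolution A T m Y := by
  induction m generalizing X Y with
  | zero =>
    have := hm 1 one_pos
    refine (hX 0).of_equiv (LinearEquiv.ofBijective ε ⟨?_, hε⟩)
    rw [injective_iff_map_eq_zero]
    intro x hx
    obtain ⟨y, rfl⟩ := (hd0 x).1 hx
    rw [Subsingleton.elim y 0, map_zero]
  | succ m ih =>
    refine ⟨X 0, _, _, ε, hX 0, hε, ih (fun j => X (j + 1)) (fun j => d (j + 1)) _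
      ((d 0).codRestrict _ fun x => hd0.apply_apply_eq_zero x) (fun j => hX (j + 1))
      (fun j hj => hm (j + 1) (by omega)) ?_ (fun x => ?_) (fun j => hd (j + 1))⟩
    · rintro ⟨x, hx⟩
      obtain ⟨y, rfl⟩ := (hd0 x).1 hx
      exact ⟨y, rfl⟩
    · rw [← hd 0 x]
      exact ⟨fun h => congrArg Subtype.val h, fun h => Subtype.ext h⟩

theorem AddResolution.hasFiniteAddResolution {m : ℕ} {Y : Type u} [AddCommGroup Y] [Module A Y]
    (h : AddResolution A T m Y) : HasFiniteAddResolution A T Y := by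
  -- The length is pinned to `m`, so that the vanishing bound can be shifted in the induction.
  suffices ∃ (X : ℕ → ModuleCat.{u} A) (d : ∀ j, X (j + 1) →ₗ[A] X j) (ε : X 0 →ₗ[A] Y),
      (∀ j, InAdd A T (X j)) ∧ (∀ j, m < j → Subsingleton (X j)) ∧
      Function.Surjective ε ∧ Function.Exact (d 0) ε ∧
      ∀ j, Function.Exact (d (j + 1)) (d j) from ⟨m, this⟩
  induction m generalizing Y with
  | zero =>
    refine ⟨fun | 0 => ModuleCat.of A Y | _ + 1 => ModuleCat.of A PUnit, fun _ => 0,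
      LinearMap.id, ?_, ?_, Function.surjective_id, ?_, ?_⟩
    · rintro (_ | j)
      · exact h
      · exact InAdd.of_subsingleton (X := PUnit)
    · rintro (_ | j) hj
      · omega
      · exact inferInstanceAs (Subsingleton PUnit)
    · intro y
      exact ⟨fun hy => ⟨0, hy.symm⟩, fun ⟨_, hy⟩ => hy.symm⟩
    · intro j y
      exact ⟨fun _ => ⟨0, Subsingleton.elim (α := PUnit) _ _⟩, fun _ => rfl⟩
  | succ m ih =>
    obtain ⟨W, _, _, g, hW, hg, hK⟩ := h
    obtain ⟨X, d, ε, hX, hm, hε, hd0, hd⟩ := ih hK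
    refine ⟨fun | 0 => ModuleCat.of A W | j + 1 => X j,
      fun | 0 => (LinearMap.ker g).subtype ∘ₗ ε | j + 1 => d j, g, ?_, ?_, hg, ?_, ?_⟩
    · rintro (_ | j)
      exacts [hW, hX j]
    · rintro (_ | j) hj
      · omega
      · exact hm j (by omega)
    · intro w
      constructor
      · intro hw
        obtain ⟨x, hx⟩ := hε ⟨w, hw⟩
        exact ⟨x, congrArg Subtype.val hx⟩
      · rintro ⟨x, rfl⟩
        exact (ε x).2
    · rintro (_ | j)
      · intro x
        rw [← hd0 x]
        exact ⟨fun h => Subtype.ext h, fun h => congrArg Subtype.val h⟩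
      · exact hd j

theorem hasFiniteAddResolution_iff {Y : Type u} [AddCommGroup Y] [Module A Y] :
    HasFiniteAddResolution A T Y ↔ ∃ m, AddResolution A T m Y := by
  constructor
  · rintro ⟨m, X, d, ε, hX, hm, hε, hd0, hd⟩
    exact ⟨m, addResolution_of_sequence m X d Y ε hX hm hε hd0 hd⟩
  · rintro ⟨m, h⟩
    exact h.hasFiniteAddResolution

theorem AddResolution.subsingleton {m : ℕ} {Y : Type u} [AddCommGroup Y] [Module A Y]
    (h : AddResolution A T m Y) [Subsingleton T] : Subsingleton Y := by
  have hsub {X : Type u} [AddCommGroup X] [Module A X] (hX : InAdd A T X) : Subsingleton X := by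
    obtain ⟨n, i, p, h⟩ := hX
    exact (Function.LeftInverse.injective (g := p) (LinearMap.congr_fun h)).subsingleton
  cases m with
  | zero => exact hsub h
  | succ m =>
    obtain ⟨W, _, _, g, hW, hg, -⟩ := h
    have := hsub hW
    exact hg.subsingleton

end FiniteAddResolution

/-! ### Tensoring resolutions -/

section TensorResolution

variable (k : Type u) {A B T L Y Z : Type u} [Field k] [Ring A] [Ring B] [Algebra k A]
  [Algebra k B] [AddCommGroup T] [AddCommGroup L] [Module k T] [Module k L]
  [Module A T] [Module B L] [IsScalarTower k A T] [IsScalarTower k B L]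
  [AddCommGroup Y] [AddCommGroup Z] [Module k Y] [Module k Z]
  [Module A Y] [Module B Z] [IsScalarTower k A Y] [IsScalarTower k B Z]

theorem AddResolution.extTensor_inAdd {m : ℕ} (hY : AddResolution A T m Y) (hZ : InAdd B L Z) :
    AddResolution (A ⊗[k] B) (ExtTensor k T L) m (ExtTensor k Y Z) := by
  induction m generalizing Y with
  | zero => exact InAdd.extTensor hY hZ
  | succ m ih =>
    obtain ⟨X, _, _, g, hX, hg, hK⟩ := hY
    let _ : Module k X := Module.restrictScalars k A X
    have : IsScalarTower k A X := IsScalarTower.restrictScalars k A X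
    exact AddResolution.of_exact
      (ExtTensor.map_id_right_exact k Z (LinearMap.exact_subtype_ker_map g))
      (ExtTensor.map_id_right_injective k Z (LinearMap.ker g).subtype_injective)
      (ExtTensor.map_id_right_surjective k Z hg) (ih hK) (hX.extTensor hZ)

-- Replaces the total complex of the two resolutions by induction on the second: `Y ⊗ Z` is the
-- cokernel of `Y ⊗ ker g → Y ⊗ X`, whose terms have length at most `m + n` and `m`.
open CategoryTheory Abelian in
theorem AddResolution.extTensor
    (hT : ∀ n : ℕ, 1 ≤ n → Subsingleton (Ext (ModuleCat.of (A ⊗[k] B) (ExtTensor k T L))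
      (ModuleCat.of (A ⊗[k] B) (ExtTensor k T L)) n))
    {m n : ℕ} (hY : AddResolution A T m Y) (hZ : AddResolution B L n Z) :
    AddResolution (A ⊗[k] B) (ExtTensor k T L) (m + n) (ExtTensor k Y Z) := by
  induction n generalizing Z with
  | zero => exact hY.extTensor_inAdd k hZ
  | succ n ih =>
    obtain ⟨X, _, _, g, hX, hg, hK⟩ := hZ
    let _ : Module k X := Module.restrictScalars k B X
    have : IsScalarTower k B X := IsScalarTower.restrictScalars k B X
    exact AddResolution.cokernel hT (ih hK) ((hY.extTensor_inAdd k hX).mono (Nat.le_add_right m n))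
      (ExtTensor.map_id_left_exact k Y (LinearMap.exact_subtype_ker_map g))
      (ExtTensor.map_id_left_injective k Y (LinearMap.ker g).subtype_injective)
      (ExtTensor.map_id_left_surjective k Y hg)

end TensorResolution

/-! ### Resolutions under restriction of scalars -/

section RestrictResolution

/-- Restriction of scalars preserves finite resolutions by summands of powers. -/
theorem AddResolution.restrict (R : Type u) {S U T W : Type u} [Ring R] [Ring S] [Module R S]
    [IsScalarTower R S S] [AddCommGroup U] [Module S U] [Module R U] [IsScalarTower R S U]
    [AddCommGroup T] [Module R T] (hU : InAdd R T U)
    [AddCommGroup W] [Module S W] [Module R W] [IsScalarTower R S W] {m : ℕ}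
    (h : AddResolution S U m W) : AddResolution R T m W := by
  have hadd {X : Type u} [AddCommGroup X] [Module S X] [Module R X] [IsScalarTower R S X]
      (hX : InAdd S U X) : InAdd R T X := by
    obtain ⟨n, i, p, h⟩ := hX
    exact InAdd.trans ⟨n, i.restrictScalars R, p.restrictScalars R,
      LinearMap.ext fun x => LinearMap.congr_fun h x⟩ hU
  induction m generalizing W with
  | zero => exact hadd h
  | succ m ih =>
    obtain ⟨X, _, _, g, hX, hg, hK⟩ := h
    -- The terms of the resolution come only with an `S`-action, so `R` must act through `r ↦ r •
    -- 1`.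
    let _ : Module R X := Module.compHom X (RingHom.smulOneHom : R →+* S)
    have : IsScalarTower R S X := ⟨fun r s x => by
      change (r • s) • x = (r • (1 : S)) • s • x
      rw [← mul_smul, smul_one_mul]⟩
    exact AddResolution.of_exact (f := (LinearMap.ker g).subtype.restrictScalars R)
      (g := g.restrictScalars R) (LinearMap.exact_subtype_ker_map g)
      (LinearMap.ker g).subtype_injective hg (ih hK) (hadd hX)

theorem AddResolution.compHom {R S U T W : Type u} [Ring R] [Ring S] (f : R →+* S)
    [AddCommGroup U] [Module S U] [AddCommGroup T] [Module R T] [AddCommGroup W] [Module S W]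
    (hU : letI := Module.compHom U f; InAdd R T U) {m : ℕ} (h : AddResolution S U m W) :
    letI := Module.compHom W f; AddResolution R T m W := by
  let _ : Module R S := Module.compHom S f
  let _ : Module R U := Module.compHom U f
  let _ : Module R W := Module.compHom W f
  have : IsScalarTower R S S := ⟨fun r s x => mul_assoc (f r) s x⟩
  have : IsScalarTower R S U := ⟨fun r s x => mul_smul (f r) s x⟩
  have : IsScalarTower R S W := ⟨fun r s x => mul_smul (f r) s x⟩
  exact AddResolution.restrict R hU h

end RestrictResolution

/-! ### Resolutions of the factors of an external tensor product -/

section ReflectResolution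

open CategoryTheory Abelian

variable (k : Type u) {A B T L X M : Type u} [Field k] [Ring A] [Ring B] [Algebra k A]
  [Algebra k B] [AddCommGroup T] [AddCommGroup L] [Module k T] [Module k L]
  [Module A T] [Module B L] [IsScalarTower k A T] [IsScalarTower k B L]
  [AddCommGroup X] [AddCommGroup M] [Module k X] [Module k M]
  [Module A X] [Module B M] [IsScalarTower k A X] [IsScalarTower k B M]

variable (A B T L) in
/-- The restriction to `A` of the `A ⊗ B`-module `T ⊗ L`. -/
noncomputable abbrev ExtTensor.moduleLeft : Module A (ExtTensor k T L) :=
  Module.compHom (ExtTensor k T L)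
    (Algebra.TensorProduct.includeLeft : A →ₐ[k] A ⊗[k] B).toRingHom

variable (A B T L) in
/-- The restriction to `B` of the `A ⊗ B`-module `T ⊗ L`. -/
noncomputable abbrev ExtTensor.moduleRight : Module B (ExtTensor k T L) :=
  Module.compHom (ExtTensor k T L)
    (Algebra.TensorProduct.includeRight : B →ₐ[k] A ⊗[k] B).toRingHom

/-- Over `A`, a basis of `L` puts `T ⊗ L` in `add(T)`, and `X` is a retract of `X ⊗ M` through `x ↦
x ⊗ n` and a functional with value `1` at `n`. -/
theorem AddResolution.left_of_extTensor [Module.Finite k T] [Module.Finite k L]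
    [Module.Finite k X] [Nontrivial M]
    (hT : ∀ n : ℕ, 1 ≤ n → Subsingleton (Ext (ModuleCat.of A T) (ModuleCat.of A T) n))
    {m : ℕ} (h : AddResolution (A ⊗[k] B) (ExtTensor k T L) m (ExtTensor k X M)) :
    AddResolution A T m X := by
  let _ := ExtTensor.moduleLeft k A B T L
  let _ := ExtTensor.moduleLeft k A B X M
  let i {Y N : Type u} [AddCommGroup Y] [AddCommGroup N] [Module k Y] [Module k N]
      [Module A Y] [Module B N] [IsScalarTower k A Y] [IsScalarTower k B N] (n : N) :
      letI := ExtTensor.moduleLeft k A B Y N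
      Y →ₗ[A] ExtTensor k Y N :=
    letI := ExtTensor.moduleLeft k A B Y N
    { toFun := fun y => ExtTensor.tmul k y n
      map_add' := fun y y' => ExtTensor.add_tmul y y' n
      map_smul' := fun a y => by
        change _ = (a ⊗ₜ[k] (1 : B)) • ExtTensor.tmul k y n
        rw [ExtTensor.smul_tmul_tmul, one_smul] }
  let p {Y N : Type u} [AddCommGroup Y] [AddCommGroup N] [Module k Y] [Module k N]
      [Module A Y] [Module B N] [IsScalarTower k A Y] [IsScalarTower k B N] (φ : N →ₗ[k] k) :
      letI := ExtTensor.moduleLeft k A B Y N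
      ExtTensor k Y N →ₗ[A] Y :=
    letI := ExtTensor.moduleLeft k A B Y N
    { toFun := ExtTensor.contract k Y φ
      map_add' := map_add _
      map_smul' := ExtTensor.contract_smul (B := B) k φ }
  have hU : InAdd A T (ExtTensor k T L) := by
    let b := Module.finBasis k L
    refine inAdd_of_sum_eq_id (fun j => p (b.coord j)) (fun j => i (b j)) (LinearMap.ext fun v => ?_)
    rw [LinearMap.sum_apply]
    exact ExtTensor.sum_contract_tmul_basis k b v
  obtain ⟨n, hn⟩ := exists_ne (0 : M)
  obtain ⟨φ, hφ⟩ := Module.Projective.exists_dual_eq_one k hn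
  refine (AddResolution.compHom _ hU h).of_retract k hT (i n) (p φ) (LinearMap.ext fun x => ?_)
  refine (ExtTensor.contract_tmul k φ x n).trans ?_
  rw [hφ, one_smul]
  rfl

theorem AddResolution.right_of_extTensor [Module.Finite k T] [Module.Finite k L]
    [Module.Finite k M] [Nontrivial X]
    (hL : ∀ n : ℕ, 1 ≤ n → Subsingleton (Ext (ModuleCat.of B L) (ModuleCat.of B L) n))
    {m : ℕ} (h : AddResolution (A ⊗[k] B) (ExtTensor k T L) m (ExtTensor k X M)) :
    AddResolution B L m M := by
  let _ := ExtTensor.moduleRight k A B T L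
  let _ := ExtTensor.moduleRight k A B X M
  let i {Y N : Type u} [AddCommGroup Y] [AddCommGroup N] [Module k Y] [Module k N]
      [Module A Y] [Module B N] [IsScalarTower k A Y] [IsScalarTower k B N] (y : Y) :
      letI := ExtTensor.moduleRight k A B Y N
      N →ₗ[B] ExtTensor k Y N :=
    letI := ExtTensor.moduleRight k A B Y N
    { toFun := fun n => ExtTensor.tmul k y n
      map_add' := fun n n' => ExtTensor.tmul_add y n n'
      map_smul' := fun b n => by
        change _ = ((1 : A) ⊗ₜ[k] b) • ExtTensor.tmul k y n
        rw [ExtTensor.smul_tmul_tmul, one_smul] }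
  let p {Y N : Type u} [AddCommGroup Y] [AddCommGroup N] [Module k Y] [Module k N]
      [Module A Y] [Module B N] [IsScalarTower k A Y] [IsScalarTower k B N] (φ : Y →ₗ[k] k) :
      letI := ExtTensor.moduleRight k A B Y N
      ExtTensor k Y N →ₗ[B] N :=
    letI := ExtTensor.moduleRight k A B Y N
    { toFun := ExtTensor.contractLeft k N φ
      map_add' := map_add _
      map_smul' := ExtTensor.contractLeft_smul (A := A) k φ }
  have hU : InAdd B L (ExtTensor k T L) := by
    let b := Module.finBasis k T
    refine inAdd_of_sum_eq_id (fun j => p (b.coord j)) (fun j => i (b j)) (LinearMap.ext fun v => ?_)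
    rw [LinearMap.sum_apply]
    exact ExtTensor.sum_contractLeft_tmul_basis k b v
  obtain ⟨x, hx⟩ := exists_ne (0 : X)
  obtain ⟨φ, hφ⟩ := Module.Projective.exists_dual_eq_one k hx
  refine (AddResolution.compHom _ hU h).of_retract k hL (i x) (p φ) (LinearMap.ext fun n => ?_)
  refine (ExtTensor.contractLeft_tmul k φ x n).trans ?_
  rw [hφ, one_smul]
  rfl

end ReflectResolution

/-! ### The cotilting conditions -/

section Main

variable (k : Type u) {A B T L : Type u} [Field k]
  [Ring A] [Algebra k A] [Module.Finite k A] [Nontrivial A]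
  [Ring B] [Algebra k B] [Module.Finite k B] [Nontrivial B]
  [AddCommGroup T] [Module k T] [Module A T] [IsScalarTower k A T] [Module.Finite k T]
  [AddCommGroup L] [Module k L] [Module B L] [IsScalarTower k B L] [Module.Finite k L]

instance (A : Type*) [Ring A] [Algebra k A] [Nontrivial A] : Nontrivial (DualRegular k A) := by
  obtain ⟨φ, hφ⟩ := Module.Projective.exists_dual_eq_one k (one_ne_zero (α := A))
  refine ⟨φ, 0, fun h => one_ne_zero (α := k) ?_⟩
  exact hφ.symm.trans (LinearMap.congr_fun (f := φ) (g := (0 : A →ₗ[k] k)) h 1)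

/-- The nonzero module `D(A)` has a finite `add(T)`-resolution, which is impossible for `T = 0`.
Both factors must be nonzero for the splittings used in the converse. -/
theorem IsRCotilting.nontrivial {A T : Type u} [Ring A] [Algebra k A] [Nontrivial A]
    [AddCommGroup T] [Module A T] {r : ℕ} (h : IsRCotilting k A T r) : Nontrivial T := by
  obtain ⟨m, hm⟩ := hasFiniteAddResolution_iff.1 h.resolution
  by_contra hT
  rw [not_nontrivial_iff_subsingleton] at hT
  exact not_subsingleton (DualRegular k A) hm.subsingleton

omit [Nontrivial A] [Nontrivial B] in
theorem IsRCotilting.extTensor {r s : ℕ} (hT : IsRCotilting k A T r) (hL : IsRCotilting k B L s) :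
    IsRCotilting k (A ⊗[k] B) (ExtTensor k T L) (r + s) where
  injDim_le := hasInjectiveDimensionLE_extTensor k r s hT.injDim_le hL.injDim_le
  ext_self := subsingleton_ext_extTensor k hT.ext_self hL.ext_self
  resolution := by
    obtain ⟨m, hm⟩ := hasFiniteAddResolution_iff.1 hT.resolution
    obtain ⟨n, hn⟩ := hasFiniteAddResolution_iff.1 hL.resolution
    exact hasFiniteAddResolution_iff.2 ⟨m + n, (AddResolution.extTensor k
      (subsingleton_ext_extTensor k hT.ext_self hL.ext_self) hm hn).of_equiv
      (dualRegularTensorEquiv k A B)⟩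

theorem IsRCotilting.of_extTensor {r : ℕ}
    (h : IsRCotilting k (A ⊗[k] B) (ExtTensor k T L) r) :
    IsRCotilting k A T r ∧ IsRCotilting k B L r := by
  have hTL : Nontrivial (T ⊗[k] L) := h.nontrivial k
  have hT : Nontrivial T := by
    by_contra hT
    rw [not_nontrivial_iff_subsingleton] at hT
    exact not_subsingleton (T ⊗[k] L) inferInstance
  have hL : Nontrivial L := by
    by_contra hL
    rw [not_nontrivial_iff_subsingleton] at hL
    exact not_subsingleton (T ⊗[k] L) inferInstance
  obtain ⟨m, hm⟩ := hasFiniteAddResolution_iff.1 h.resolution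
  have hm' := hm.of_equiv (dualRegularTensorEquiv k A B).symm
  have hextT := fun s hs => subsingleton_ext_left_of_extTensor k s (h.ext_self s hs)
  have hextL := fun s hs => subsingleton_ext_right_of_extTensor k s (h.ext_self s hs)
  exact ⟨⟨hasInjectiveDimensionLE_left_of_extTensor k r h.injDim_le, hextT,
      hasFiniteAddResolution_iff.2 ⟨m, hm'.left_of_extTensor k hextT⟩⟩,
    ⟨hasInjectiveDimensionLE_right_of_extTensor k r h.injDim_le, hextL,
      hasFiniteAddResolution_iff.2 ⟨m, hm'.right_of_extTensor k hextL⟩⟩⟩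

end Main

theorem proposition3p2 (k A B T L : Type u) [Field k]
    [Ring A] [Algebra k A] [Module.Finite k A] [Nontrivial A]
    [Ring B] [Algebra k B] [Module.Finite k B] [Nontrivial B]
    [AddCommGroup T] [Module k T] [Module A T] [IsScalarTower k A T] [Module.Finite k T]
    [AddCommGroup L] [Module k L] [Module B L] [IsScalarTower k B L] [Module.Finite k L] :
    (IsCotilting k (A ⊗[k] B) (ExtTensor k T L) ↔ IsCotilting k A T ∧ IsCotilting k B L) ∧
    (IsCotilting k (A ⊗[k] B) (ExtTensor k T L) →
      Nonempty (Module.End (A ⊗[k] B) (ExtTensor k T L) ≃ₐ[k]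
        Module.End A T ⊗[k] Module.End B L)) := by
  refine ⟨⟨fun ⟨r, h⟩ => ⟨⟨r, (h.of_extTensor k).1⟩, ⟨r, (h.of_extTensor k).2⟩⟩,
    fun ⟨⟨r, hT⟩, ⟨s, hL⟩⟩ => ⟨r + s, hT.extTensor k hL⟩⟩, fun _ => ⟨?_⟩⟩
  exact (AlgEquiv.ofBijective (ExtTensor.endTensorHom k A B T L)
    (ExtTensor.endTensorHom_bijective k)).symm
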